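/- **Proposition 3.10 (descent by torsors).** Let $S$ be a scheme, $\mathcal S=\mathrm{Sch}/S$, and $\tau\in\{\text{ét},\text{fppf}\}$. For a category $\mathcal T$ fibred in groupoids over $\mathcal S$, let $\mathcal T_\tau$ be $\mathcal T$ with the topology inherited from the big site $\mathcal S_\tau$. For $\mathcal X,\mathcal T$ fibred in groupoids over $\mathcal S$ let $\mathcal X(\mathcal T)$ be the groupoid of $1$-morphisms $\mathcal T\to\mathcal X$ over $\mathcal S$; for a $1$-morphism $f:\mathcal Y\to\mathcal X$ over $\mathcal S$ let $f(\mathcal Y(\mathcal T))\subseteq\mathcal X(\mathcal T)$ be the full subcategory of those $x$ that are $2$-isomorphic over $\mathcal S$ to $f\circ y$ for some $y\in\mathcal Y(\mathcal T)$. (The universe in which sheaves take values is large enough for the sites $\mathcal S_\tau$ and $\mathcal X_\tau$ below to be small with respect to it.) Let $q:\mathcal A\to\mathcal S$ be fibred in sets and let $a:\mathcal X\to\mathcal S$ be fibred in setoids. For a sheaf of groups $\mathscr G$ on $\mathcal S_\tau$ (also denoting its pull-backs), let $\mathsf H^1_\tau(\mathcal T,\mathscr G)$ be the set of isomorphism classes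 of right $\mathscr G$-torsors over $\mathcal T_\tau$. For $A\in\mathsf H^1_\tau(\mathcal X,\mathscr G)$ let $\mathcal X(\mathcal A)^A$ be the full subcategory of $\mathcal X(\mathcal A)$ of those $x$ for which $x^*A$ lies in the image of $q^*:\mathsf H^1_\tau(\mathcal S,\mathscr G)\to\mathsf H^1_\tau(\mathcal A,\mathscr G)$, and let $$\mathcal X(\mathcal A)^{\mathrm{desc}}=\bigcap_{\mathscr G}\ \bigcap_{A\in\mathsf H^1_{\mathrm{fppf}}(\mathcal X,\mathscr G)}\mathcal X(\mathcal A)^{A},$$ $\mathscr G$ running over all sheaves of groups on $\mathcal S_{\mathrm{fppf}}$. For a $\mathscr G$-torsor $\mathscr Y$ over $\mathcal X_\tau$ with associated fibred category $f:\mathcal Y\to\mathcal X$ (objects: pairs of an object of $\mathcal X$ and a section of $\mathscr Y$ over it), put $\mathcal X(\mathcal A)^f=\mathcal X(\mathcal A)^{[\mathscr Y]}$. For a class $\sigma$ in the non-abelian Čech cohomology $\check H^1_\tau(\mathcal S,\mathscr G)$ (the colimit over all coverings of the final object $S$), represented by a $\mathscr G$-torsor $\mathscr Z$ over $\mathcal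 S_\tau$, a twist of $f$ by $\sigma$ is the fibred category $f^\sigma:\mathcal Y^\sigma\to\mathcal X$ associated to any torsor isomorphic to the contracted product $\mathscr Y\times^{\mathscr G}(a^*\mathscr Z)^\circ$, where $(\cdot)^\circ$ denotes the inverse torsor; it is a torsor under a sheaf of groups $\mathscr G^\sigma\cong a^*\mathrm{Aut}_{\mathscr G}(\mathscr Z)$. Then: 1. For every $\tau$, every sheaf of groups $\mathscr G$ on $\mathcal S_\tau$ and every $\mathscr G$-torsor $f:\mathcal Y\to\mathcal X$ over $\mathcal X_\tau$, a twist $f^\sigma$ exists for every $\sigma\in\check H^1_\tau(\mathcal S,\mathscr G)$, and for every choice of twists $$\mathcal X(\mathcal A)^f=\bigcup_{\sigma\in\check H^1_\tau(\mathcal S,\mathscr G)}f^\sigma(\mathcal Y^\sigma(\mathcal A)).$$ 2. For every choice of twists, $$\mathcal X(\mathcal A)^{\mathrm{desc}}=\bigcap_{\mathscr G,\ f}\ \bigcup_{\sigma\in\check H^1_{\mathrm{fppf}}(\mathcal S,\mathscr G)}f^\sigma(\mathcal Y^\sigma(\mathcal A)),$$ where $\mathscr G$ runs over all sheaves of groups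 on $\mathcal S_{\mathrm{fppf}}$ and $f:\mathcal Y\to\mathcal X$ over all $\mathscr G$-torsors over $\mathcal X_{\mathrm{fppf}}$. 3. For $\tau,\mathscr G,f$ as in 1 and every choice of twists, $$\mathcal X(\mathcal S)=\bigcup_{\sigma\in\check H^1_\tau(\mathcal S,\mathscr G)}f^\sigma(\mathcal Y^\sigma(\mathcal S)).$$ -/

import Mathlib

open CategoryTheory Opposite
universe w u v₀ u₀ v₁ u₁ v₂ u₂ v₃ u₃

namespace DescentByTorsors
open Functor
variable {𝒮 : Type u₀} [Category.{v₀} 𝒮]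

/-- A category fibred in groupoids over `𝒮`. -/
class IsFibredInGroupoids (𝒳 : BasedCategory.{v₁, u₁} 𝒮) : Prop where
  isFibered : 𝒳.p.IsFibered
  isGroupoid : ∀ U : 𝒮, IsGroupoid (Fiber 𝒳.p U)

/-- A category fibred in setoids over `𝒮`. -/
class IsFibredInSetoids (𝒳 : BasedCategory.{v₁, u₁} 𝒮) : Prop extends
    IsFibredInGroupoids 𝒳 where
  isThin : ∀ U : 𝒮, Quiver.IsThin (Fiber 𝒳.p U)

/-- A category fibred in sets over `𝒮`. -/
class IsFibredInSets (𝒳 : BasedCategory.{v₁, u₁} 𝒮) : Prop where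
  isFibered : 𝒳.p.IsFibered
  isDiscrete : ∀ U : 𝒮, IsDiscrete (Fiber 𝒳.p U)

instance (𝒳 : BasedCategory.{v₁, u₁} 𝒮) [IsFibredInSets 𝒳] : IsFibredInSetoids 𝒳 where
  isFibered := IsFibredInSets.isFibered
  isGroupoid U :=
    have : IsDiscrete (Fiber 𝒳.p U) := IsFibredInSets.isDiscrete U
    { all_isIso := inferInstance }
  isThin U :=
    have : IsDiscrete (Fiber 𝒳.p U) := IsFibredInSets.isDiscrete U
    fun _ _ => inferInstance

/-- The base category `𝒮`, as a category fibred over itself. -/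
def baseCategory (𝒮 : Type u₀) [Category.{v₀} 𝒮] : BasedCategory.{v₀, u₀} 𝒮 :=
  BasedCategory.ofFunctor (Functor.id 𝒮)

lemma isFibered_id : (Functor.id 𝒮).IsFibered := by
  refine IsFibered.of_exists_isStronglyCartesian fun a R f => ⟨R, f, ?_⟩
  have h1 : (Functor.id 𝒮).IsHomLift f f := CategoryTheory.IsHomLift.map (Functor.id 𝒮) f
  refine { toIsHomLift := h1, universal_property' := fun {a'} g φ' h => ⟨g, ⟨?_, ?_⟩, ?_⟩ }
  · exact CategoryTheory.IsHomLift.map (Functor.id 𝒮) g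
  · exact IsHomLift.eq_of_isHomLift (Functor.id 𝒮) (g ≫ f) φ'
  · rintro y ⟨hy, -⟩
    exact (IsHomLift.eq_of_isHomLift (Functor.id 𝒮) g y).symm

lemma isDiscrete_fiber_id (U : 𝒮) : IsDiscrete (Fiber (Functor.id 𝒮) U) where
  subsingleton := by
    rintro ⟨X, hX⟩ ⟨Y, hY⟩
    obtain rfl : X = U := hX
    obtain rfl : Y = X := hY
    refine ⟨fun f g => Subtype.ext ?_⟩
    have := f.2
    have := g.2
    exact (IsHomLift.eq_of_isHomLift (Functor.id 𝒮) (𝟙 Y) f.1).symm.trans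
      (IsHomLift.eq_of_isHomLift (Functor.id 𝒮) (𝟙 Y) g.1)
  eq_of_hom := by
    rintro ⟨X, hX⟩ ⟨Y, hY⟩ _
    exact Subtype.ext (hX.trans hY.symm)

instance : IsFibredInSets (baseCategory 𝒮) where
  isFibered := isFibered_id
  isDiscrete := isDiscrete_fiber_id

/-- Every morphism of a category fibred in groupoids is strongly cartesian. -/
lemma isStronglyCartesian (𝒳 : BasedCategory.{v₁, u₁} 𝒮) [IsFibredInGroupoids 𝒳] {R S : 𝒮}
    (f : R ⟶ S) {a b : 𝒳.obj} (φ : a ⟶ b) [𝒳.p.IsHomLift f φ] :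
    𝒳.p.IsStronglyCartesian f φ := by
  have := IsFibredInGroupoids.isFibered (𝒳 := 𝒳)
  obtain ⟨a', ψ, hψ⟩ := IsPreFibered.exists_isCartesian 𝒳.p (IsHomLift.codomain_eq 𝒳.p f φ) f
  have := IsFibredInGroupoids.isGroupoid (𝒳 := 𝒳) R
  let χ := IsCartesian.map 𝒳.p f ψ φ
  have h1 : IsIso (Fiber.homMk 𝒳.p R χ) := inferInstance
  have h2 : IsIso χ := by
    have : IsIso (Fiber.fiberInclusion.map (Fiber.homMk 𝒳.p R χ)) := inferInstance
    simpa using this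
  have h3 : 𝒳.p.IsHomLift (𝟙 R) (asIso χ).hom := inferInstanceAs (𝒳.p.IsHomLift (𝟙 R) χ)
  have h4 : 𝒳.p.IsCartesian f ((asIso χ).hom ≫ ψ) := inferInstance
  have h5 : (asIso χ).hom ≫ ψ = φ := IsCartesian.fac 𝒳.p f ψ φ
  rw [h5] at h4
  infer_instance


section Topology

variable (K : GrothendieckTopology 𝒮)

/-- Every morphism of the base with target `p x` lifts to a morphism with target `x`. -/
lemma exists_lift (𝒳 : BasedCategory.{v₁, u₁} 𝒮) [IsFibredInGroupoids 𝒳] {x : 𝒳.obj} {V : 𝒮}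
    (h : V ⟶ 𝒳.p.obj x) : ∃ (y : 𝒳.obj) (hy : 𝒳.p.obj y = V) (φ : y ⟶ x),
      𝒳.p.map φ = eqToHom hy ≫ h := by
  have := IsFibredInGroupoids.isFibered (𝒳 := 𝒳)
  obtain ⟨y, φ, hφ⟩ := IsPreFibered.exists_isCartesian 𝒳.p (a := x) rfl h
  exact ⟨y, IsHomLift.domain_eq 𝒳.p h φ, φ, by simpa using IsHomLift.fac' 𝒳.p h φ⟩

/-- Every triangle in the base over two given morphisms with the same target lifts uniquely. -/
lemma exists_factor (𝒳 : BasedCategory.{v₁, u₁} 𝒮) [IsFibredInGroupoids 𝒳] {x y z : 𝒳.obj}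
    (φ : y ⟶ x) (ψ : z ⟶ x) (k : 𝒳.p.obj y ⟶ 𝒳.p.obj z) (hk : 𝒳.p.map φ = k ≫ 𝒳.p.map ψ) :
    ∃! χ : y ⟶ z, 𝒳.p.map χ = k ∧ χ ≫ ψ = φ := by
  have := isStronglyCartesian 𝒳 (𝒳.p.map ψ) ψ
  have : 𝒳.p.IsHomLift (k ≫ 𝒳.p.map ψ) φ := hk ▸ CategoryTheory.IsHomLift.map 𝒳.p φ
  obtain ⟨χ, ⟨h1, h2⟩, h3⟩ := IsStronglyCartesian.universal_property' (p := 𝒳.p)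
    (f := 𝒳.p.map ψ) (φ := ψ) k φ
  refine ⟨χ, ⟨(IsHomLift.eq_of_isHomLift 𝒳.p k χ).symm, h2⟩, ?_⟩
  rintro χ' ⟨rfl, h5⟩
  exact h3 χ' ⟨inferInstance, h5⟩

/-- The topology on `𝒳` inherited from the topology `K` of the base: a sieve on `x` is covering if
and only if its image in the base generates a covering sieve of `p x`. -/
def inheritedTopology (𝒳 : BasedCategory.{v₁, u₁} 𝒮) [IsFibredInGroupoids 𝒳] :
    GrothendieckTopology 𝒳.obj where
  sieves x := {R | R.functorPushforward 𝒳.p ∈ K (𝒳.p.obj x)}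
  top_mem' x := by simp
  pullback_stable' x y R f hR := by
    refine K.superset_covering ?_ (K.pullback_stable (𝒳.p.map f) hR)
    rintro V h ⟨z, g, k, hg, e⟩
    obtain ⟨y', rfl, φ, hφ⟩ := exists_lift 𝒳 h
    obtain ⟨χ, ⟨-, h2⟩, -⟩ := exists_factor 𝒳 (φ ≫ f) g k (by simpa [hφ] using e)
    refine ⟨y', φ, 𝟙 _, ?_, by simp [hφ]⟩
    change R.arrows (φ ≫ f)
    rw [← h2]
    exact R.downward_closed hg χ
  transitive' x R hR R' h := by
    refine K.transitive hR _ ?_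
    rintro V _ ⟨z, g, k, hg, rfl⟩
    rw [Sieve.pullback_comp]
    refine K.pullback_stable k (K.superset_covering ?_ (h hg))
    rintro W _ ⟨z', g', k', hg', rfl⟩
    exact ⟨z', g' ≫ g, k', hg', by simp⟩

variable {K} in
lemma mem_inheritedTopology_iff (𝒳 : BasedCategory.{v₁, u₁} 𝒮) [IsFibredInGroupoids 𝒳]
    {x : 𝒳.obj} (R : Sieve x) :
    R ∈ inheritedTopology K 𝒳 x ↔ R.functorPushforward 𝒳.p ∈ K (𝒳.p.obj x) := Iff.rfl

lemma inheritedTopology_baseCategory : inheritedTopology K (baseCategory 𝒮) = K := by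
  ext x R
  rw [mem_inheritedTopology_iff]
  exact iff_of_eq (congrArg (· ∈ K x) (Sieve.functorPushforward_id R))

variable {𝒜 : BasedCategory.{v₂, u₂} 𝒮} {𝒳 : BasedCategory.{v₁, u₁} 𝒮}
  [IsFibredInGroupoids 𝒜] [IsFibredInGroupoids 𝒳] (F : BasedFunctor 𝒜 𝒳)

/-- A `1`-morphism preserves covering sieves. -/
lemma coverPreserving :
    CoverPreserving (inheritedTopology K 𝒜) (inheritedTopology K 𝒳) F.toFunctor where
  cover_preserve {a R} hR := by
    rw [mem_inheritedTopology_iff] at hR ⊢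
    rw [← Sieve.functorPushforward_comp]
    have key : ∀ r : 𝒜.obj ⥤ 𝒮, r = 𝒜.p → R.functorPushforward r ∈ K (r.obj a) := by
      rintro _ rfl; exact hR
    exact key _ F.w

/-- Morphisms into the image of a `1`-morphism come, up to isomorphism, from morphisms in the
source. -/
lemma exists_lift_functor {a : 𝒜.obj} {z : 𝒳.obj} (h : z ⟶ F.obj a) :
    ∃ (c : 𝒜.obj) (ℓ : c ⟶ a) (θ : z ≅ F.obj c) (e : 𝒳.p.obj z = 𝒜.p.obj c),
      𝒳.p.map θ.hom = eqToHom (e.trans (F.w_obj c).symm) ∧ θ.hom ≫ F.map ℓ = h ∧ 𝒜.p.map ℓ = eqToHom e.symm ≫ 𝒳.p.map h ≫ eqToHom (F.w_obj a) := by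
  obtain ⟨c, hc, ℓ, hℓ⟩ := exists_lift 𝒜 (𝒳.p.map h ≫ eqToHom (F.w_obj a))
  have e1 : 𝒳.p.map (F.map ℓ) = eqToHom ((F.w_obj c).trans hc) ≫ 𝒳.p.map h := by
    have := congr_hom F.w ℓ
    dsimp at this
    rw [this, hℓ]
    simp
  have e2 : 𝒳.p.obj z = 𝒳.p.obj (F.obj c) := ((F.w_obj c).trans hc).symm
  obtain ⟨θ, ⟨h1, h2⟩, -⟩ := exists_factor 𝒳 h (F.map ℓ) (eqToHom e2) (by rw [e1]; simp)
  have : IsIso θ := by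
    have : 𝒳.p.IsHomLift (eqToHom e2) θ := h1 ▸ CategoryTheory.IsHomLift.map 𝒳.p θ
    have := isStronglyCartesian 𝒳 (eqToHom e2) θ
    exact IsStronglyCartesian.isIso_of_base_isIso 𝒳.p (eqToHom e2) θ
  exact ⟨c, ℓ, asIso θ, hc.symm, h1, h2, hℓ⟩

instance isCocontinuous :
    F.toFunctor.IsCocontinuous (inheritedTopology K 𝒜) (inheritedTopology K 𝒳) where
  cover_lift {a R} hR := by
    rw [mem_inheritedTopology_iff] at hR ⊢
    have hR' := K.pullback_stable (eqToHom (F.w_obj a).symm) hR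
    refine K.superset_covering ?_ hR'
    rintro V h ⟨z, g, k, hg, e⟩
    obtain ⟨c, ℓ, θ, ec, hθ, h1, h2⟩ := exists_lift_functor F g
    refine ⟨c, ℓ, k ≫ eqToHom ec, ?_, ?_⟩
    · change R.arrows (F.map ℓ)
      rw [(Iso.eq_inv_comp θ).2 h1]
      exact R.downward_closed hg _
    · rw [h2, Category.assoc, eqToHom_trans_assoc, eqToHom_refl, Category.id_comp,
        ← reassoc_of% e]
      simp

instance isContinuous :
    F.toFunctor.IsContinuous (inheritedTopology K 𝒜) (inheritedTopology K 𝒳) := by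
  refine Functor.isContinuous_of_coverPreserving ⟨?_⟩ (coverPreserving K F)
  intro ℱ a T s hs y₁ y₂ z f₁ f₂ g₁ g₂ hg₁ hg₂ e
  obtain ⟨c, ℓ, θ, ec, hθ, h1, h2⟩ := exists_lift_functor F (f₁ ≫ F.map g₁)
  have key : ∀ {y : 𝒜.obj} (f : z ⟶ F.obj y) (g : y ⟶ a), f ≫ F.map g = f₁ ≫ F.map g₁ →
      ∃ k : c ⟶ y, k ≫ g = ℓ ∧ θ.hom ≫ F.map k = f := by
    intro y f g hfg
    have hg : 𝒳.p.map (F.map g) = eqToHom (F.w_obj y) ≫ 𝒜.p.map g ≫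
        eqToHom (F.w_obj a).symm := by simpa using congr_hom F.w g
    obtain ⟨k, ⟨hk, hk'⟩, -⟩ := exists_factor 𝒜 ℓ g
      (eqToHom ec.symm ≫ 𝒳.p.map f ≫ eqToHom (F.w_obj y)) (by
        rw [h2, ← hfg, Functor.map_comp, hg]; simp)
    refine ⟨k, hk', ?_⟩
    refine (exists_factor 𝒳 (f ≫ F.map g) (F.map g) (𝒳.p.map f) (by simp)).unique
      ⟨?_, ?_⟩ ⟨rfl, rfl⟩
    · have hFk : 𝒳.p.map (F.map k) = eqToHom (F.w_obj c) ≫ 𝒜.p.map k ≫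
          eqToHom (F.w_obj y).symm := by simpa using congr_hom F.w k
      rw [Functor.map_comp, hθ, hFk, hk]; simp
    · rw [Category.assoc, ← Functor.map_comp, hk', h1, hfg]
  obtain ⟨k₁, hk₁, e₁⟩ := key f₁ g₁ rfl
  obtain ⟨k₂, hk₂, e₂⟩ := key f₂ g₂ e.symm
  have := hs k₁ k₂ hg₁ hg₂ (hk₁.trans hk₂.symm)
  rw [← e₁, ← e₂]
  simp only [op_comp, Functor.map_comp_apply]
  exact congrArg (ℱ.obj.map θ.hom.op) this

end Topology


section Torsors

variable {C : Type u₁} [Category.{v₁} C] {J : GrothendieckTopology C}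

/-- A (right) `G`-torsor over the site `(C, J)`: a sheaf of sets `Y` with a right action of the
sheaf of groups `G`, such that `Y` has sections locally (i.e. `Y → e` is an epimorphism of
sheaves) and such that `Y × G → Y × Y`, `(y, g) ↦ (y, y g)`, is an isomorphism. -/
structure Torsor (J : GrothendieckTopology C) (G : Sheaf J GrpCat.{w}) where
  /-- the underlying sheaf of sets -/
  Y : Sheaf J (Type w)
  /-- the right action of `G` -/
  act : ∀ {U : C}, Y.obj.obj (op U) → G.obj.obj (op U) → Y.obj.obj (op U)
  act_one : ∀ {U : C} (y : Y.obj.obj (op U)), act y 1 = y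
  act_mul : ∀ {U : C} (y : Y.obj.obj (op U)) (g h : G.obj.obj (op U)),
    act y (g * h) = act (act y g) h
  map_act : ∀ {U V : C} (f : V ⟶ U) (y : Y.obj.obj (op U)) (g : G.obj.obj (op U)),
    Y.obj.map f.op (act y g) = act (Y.obj.map f.op y) (G.obj.map f.op g)
  locally_nonempty : ∀ U : C, ∃ R ∈ J U, ∀ ⦃V : C⦄ (f : V ⟶ U), R f →
    Nonempty (Y.obj.obj (op V))
  bijective : ∀ U : C, Function.Bijective
    (fun p : Y.obj.obj (op U) × G.obj.obj (op U) => (p.1, act p.1 p.2))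

namespace Torsor

variable {G : Sheaf J GrpCat.{w}}

/-- A morphism of `G`-torsors: a `G`-equivariant morphism of sheaves. -/
@[ext]
structure Hom (Y Z : Torsor J G) where
  /-- the underlying morphism of sheaves -/
  hom : Y.Y ⟶ Z.Y
  hom_act : ∀ {U : C} (y : Y.Y.obj.obj (op U)) (g : G.obj.obj (op U)),
    hom.hom.app (op U) (Y.act y g) = Z.act (hom.hom.app (op U) y) g

/-- The category of `G`-torsors over `(C, J)`. -/
instance : Category (Torsor J G) where
  Hom := Hom
  id Y := ⟨𝟙 _, fun _ _ => rfl⟩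
  comp f g := ⟨f.hom ≫ g.hom, fun y a => by simp [f.hom_act, g.hom_act]⟩

/-- The pointed set of isomorphism classes of `G`-torsors over `(C, J)`. -/
def H1 (J : GrothendieckTopology C) (G : Sheaf J GrpCat.{w}) : Type _ :=
  Quotient (isIsomorphicSetoid (Torsor J G))

/-- The class of a torsor. -/
def cls (Y : Torsor J G) : H1 J G := Quotient.mk (isIsomorphicSetoid (Torsor J G)) Y

variable {D : Type u₂} [Category.{v₂} D] {L : GrothendieckTopology D}

/-- Pull-back of torsors along a morphism of sites `u` which is composition with `u` on sheaves;
`e` identifies the group `H` with the pull-back of the group `G`. -/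
def pullback (u : D ⥤ C) [u.IsContinuous L J] [u.IsCocontinuous L J] {H : Sheaf L GrpCat.{w}}
    (e : H.obj ≅ u.op ⋙ G.obj) : Torsor J G ⥤ Torsor L H where
  obj Y :=
    { Y := (u.sheafPushforwardContinuous (Type w) L J).obj Y.Y
      act := fun {U} y g => Y.act (U := u.obj U) y (e.hom.app (op U) g)
      act_one := fun {U} y => by rw [map_one]; exact Y.act_one (U := u.obj U) y
      act_mul := fun {U} y g h => by rw [map_mul]; exact Y.act_mul (U := u.obj U) y _ _
      map_act := fun {U V} f y g => by
        have h1 := Y.map_act (u.map f) y (e.hom.app (op U) g)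
        have h2 : e.hom.app (op V) (H.obj.map f.op g) =
            G.obj.map (u.map f).op (e.hom.app (op U) g) :=
          ConcreteCategory.congr_hom (e.hom.naturality f.op) g
        rw [h2]
        exact h1
      locally_nonempty := fun U => by
        obtain ⟨R, hR, h⟩ := Y.locally_nonempty (u.obj U)
        exact ⟨R.functorPullback u, u.cover_lift L J hR, fun V f hf => h (u.map f) hf⟩
      bijective := fun U => by
        have h := Y.bijective (u.obj U)
        have h' : Function.Bijective (Prod.map (id : Y.Y.obj.obj (op (u.obj U)) → _)
            (fun g : H.obj.obj (op U) => e.hom.app (op U) g)) :=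
          Function.bijective_id.prodMap (ConcreteCategory.bijective_of_isIso (e.hom.app (op U)))
        exact h.comp h' }
  map f := ⟨(u.sheafPushforwardContinuous (Type w) L J).map f.hom, fun y g => f.hom_act _ _⟩

/-- The map induced by pull-back on isomorphism classes of torsors. -/
def H1.pullback (u : D ⥤ C) [u.IsContinuous L J] [u.IsCocontinuous L J] {H : Sheaf L GrpCat.{w}}
    (e : H.obj ≅ u.op ⋙ G.obj) : H1 J G → H1 L H :=
  Quotient.map (Torsor.pullback u e).obj fun _ _ ⟨i⟩ => ⟨(Torsor.pullback u e).mapIso i⟩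

end Torsor

end Torsors

section Cech

variable {C : Type u₁} [Category.{v₁} C] {J : GrothendieckTopology C}

/-- The Cech `1`-cocycles with respect to a covering `R` of the final object `T`: families of
sections `g_{ij}` of `G` on `U_i × U_j`, where the `U_i` are the members of `R`, such that
`g_{ij} g_{jk} = g_{ik}`. -/
abbrev CechCocycle {T : C} (G : Sheaf J GrpCat.{w}) (R : J.Cover T) :=
  PresheafOfGroups.OneCocycle G.obj (fun I : R.Arrow => I.Y)

/-- The restriction of a cocycle to a finer covering. -/
def CechCocycle.restrict {T : C} {G : Sheaf J GrpCat.{w}} {R R' : J.Cover T}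
    (γ : CechCocycle G R) (h : R' ⟶ R) : CechCocycle G R' :=
  { ev := fun i j _ a b => γ.ev (i.map h) (j.map h) a b
    ev_precomp := fun i j _ _ φ a b => γ.ev_precomp (i.map h) (j.map h) φ a b
    ev_trans := fun i j k _ a b c => γ.ev_trans (i.map h) (j.map h) (k.map h) a b c }

lemma CechCocycle.restrict_isCohomologous {T : C} {G : Sheaf J GrpCat.{w}} {R R' : J.Cover T}
    {γ γ' : CechCocycle G R} (e : γ.IsCohomologous γ') (h : R' ⟶ R) :
    (γ.restrict h).IsCohomologous (γ'.restrict h) := by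
  obtain ⟨α, hα⟩ := e
  exact ⟨fun I => α (I.map h), fun i j _ a b => hα (i.map h) (j.map h) a b⟩

/-- Two cocycles on two coverings are equivalent if they become cohomologous on a common
refinement. -/
def cechSetoid (G : Sheaf J GrpCat.{w}) (T : C) :
    Setoid (Σ R : J.Cover T, CechCocycle G R) where
  r c d := ∃ (R : J.Cover T) (h : R ⟶ c.1) (h' : R ⟶ d.1),
    (c.2.restrict h).IsCohomologous (d.2.restrict h')
  iseqv :=
    { refl := fun c => ⟨c.1, 𝟙 _, 𝟙 _,
        (PresheafOfGroups.OneCocycle.equivalence_isCohomologous _ _).refl _⟩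
      symm := fun ⟨R, h, h', e⟩ => ⟨R, h', h,
        (PresheafOfGroups.OneCocycle.equivalence_isCohomologous _ _).symm e⟩
      trans := fun {c d e} ⟨R, h₁, h₂, e₁⟩ ⟨R', h₂', h₃, e₂⟩ => by
        refine ⟨R ⊓ R', homOfLE inf_le_left ≫ h₁, homOfLE inf_le_right ≫ h₃, ?_⟩
        exact (PresheafOfGroups.OneCocycle.equivalence_isCohomologous _ _).trans
          (CechCocycle.restrict_isCohomologous e₁ (homOfLE inf_le_left : R ⊓ R' ⟶ R))
          (CechCocycle.restrict_isCohomologous e₂ (homOfLE inf_le_right : R ⊓ R' ⟶ R')) }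

/-- The first (non-abelian) Cech cohomology of a site with final object `T`: the filtered colimit
over all coverings `R` of `T` of the Cech cohomology with respect to `R`. As `T` is final, the
products `U_i × U_j` are products over `T`. -/
def CechH1 (G : Sheaf J GrpCat.{w}) {T : C} (_hT : Limits.IsTerminal T) : Type _ :=
  Quotient (cechSetoid G T)

/-- A torsor `Z` represents the Cech class `σ` if, on some covering, `Z` has local sections `z_i`
such that the elements `g_{ij}` with `z_i g_{ij} = z_j` form a cocycle of class `σ`. -/
def Torsor.Represents {G : Sheaf J GrpCat.{w}} (Z : Torsor J G) {T : C}
    {hT : Limits.IsTerminal T} (σ : CechH1 G hT) : Prop :=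
  ∃ (R : J.Cover T) (γ : CechCocycle G R) (z : ∀ I : R.Arrow, Z.Y.obj.obj (op I.Y)),
    σ = Quotient.mk (cechSetoid G T) ⟨R, γ⟩ ∧
    ∀ (I I' : R.Arrow) (V : C) (a : V ⟶ I.Y) (b : V ⟶ I'.Y),
      Z.act (Z.Y.obj.map a.op (z I)) (γ.ev I I' a b) = Z.Y.obj.map b.op (z I')

end Cech

section Contracted

variable {C : Type u₁} [Category.{v₁} C] {J : GrothendieckTopology C} {G : Sheaf J GrpCat.{w}}

/-- The group of automorphisms of the restriction to `C/U` of the `G`-torsor `Z`. -/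
def Torsor.adSections (Z : Torsor J G) (U : C) :
    Subgroup (∀ (V : C) (_ : V ⟶ U), Equiv.Perm (Z.Y.obj.obj (op V))) where
  carrier := {φ |
    (∀ (V W : C) (f : V ⟶ U) (k : W ⟶ V) (z : Z.Y.obj.obj (op V)),
      Z.Y.obj.map k.op (φ V f z) = φ W (k ≫ f) (Z.Y.obj.map k.op z)) ∧
    ∀ (V : C) (f : V ⟶ U) (z : Z.Y.obj.obj (op V)) (g : G.obj.obj (op V)),
      φ V f (Z.act z g) = Z.act (φ V f z) g}
  one_mem' := ⟨fun _ _ _ _ _ => rfl, fun _ _ _ _ => rfl⟩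
  mul_mem' := by
    rintro φ ψ ⟨h1, h2⟩ ⟨h3, h4⟩
    refine ⟨fun V W f k z => ?_, fun V f z g => ?_⟩
    · exact (h1 V W f k _).trans (congrArg _ (h3 V W f k z))
    · exact (congrArg _ (h4 V f z g)).trans (h2 V f _ g)
  inv_mem' := by
    rintro φ ⟨h1, h2⟩
    refine ⟨fun V W f k z => ?_, fun V f z g => ?_⟩
    · apply (φ W (k ≫ f)).injective
      refine (h1 V W f k _).symm.trans ?_
      simp
    · apply (φ V f).injective
      refine Eq.trans ?_ (h2 V f _ g).symm
      simp

/-- The adjoint group `ad(Z) = Aut_G(Z)` of a `G`-torsor `Z`. -/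
def Torsor.ad (Z : Torsor J G) : Cᵒᵖ ⥤ GrpCat.{max u₁ v₁ w} where
  obj U := GrpCat.of (Z.adSections U.unop)
  map {U U'} f := GrpCat.ofHom
    { toFun := fun φ => ⟨fun V k => φ.1 V (k ≫ f.unop),
        fun V W k k' z => by simpa using φ.2.1 V W (k ≫ f.unop) k' z,
        fun V k z g => φ.2.2 V (k ≫ f.unop) z g⟩
      map_one' := rfl
      map_mul' := fun _ _ => rfl }
  map_id U := GrpCat.hom_ext (MonoidHom.ext fun φ => Subtype.ext (by
    funext V k
    exact congrArg (φ.1 V) (Category.comp_id k)))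
  map_comp f g := GrpCat.hom_ext (MonoidHom.ext fun φ => Subtype.ext (by
    funext V k
    exact congrArg (φ.1 V) (Category.assoc k g.unop f.unop).symm))

/-- The left action of `ad(Z)` on `Z`. -/
def Torsor.adAct (Z : Torsor J G) {U : C} (φ : Z.ad.obj (op U)) (z : Z.Y.obj.obj (op U)) :
    Z.Y.obj.obj (op U) :=
  φ.1 U (𝟙 U) z

/-- The left action of `G` on the inverse torsor `Z°`, whose underlying sheaf is that of `Z`. -/
def Torsor.invAct (Z : Torsor J G) {U : C} (g : G.obj.obj (op U)) (z : Z.Y.obj.obj (op U)) :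
    Z.Y.obj.obj (op U) :=
  Z.act z g⁻¹

/-- The diagonal operation `(y, z) ↦ (y g, g⁻¹ z)` of `G` on the sections of `Y × Z°`. -/
def orbitSetoid (Y Z : Torsor J G) (U : C) :
    Setoid (Y.Y.obj.obj (op U) × Z.Y.obj.obj (op U)) where
  r p q := ∃ g : G.obj.obj (op U), q = (Y.act p.1 g, Z.invAct g⁻¹ p.2)
  iseqv :=
    { refl := fun p => ⟨1, by simp [Torsor.invAct, Torsor.act_one]⟩
      symm := by
        rintro p _ ⟨g, rfl⟩
        refine ⟨g⁻¹, ?_⟩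
        simp [Torsor.invAct, ← Torsor.act_mul, Torsor.act_one]
      trans := by
        rintro p _ _ ⟨g, rfl⟩ ⟨h, rfl⟩
        refine ⟨g * h, ?_⟩
        simp [Torsor.invAct, ← Torsor.act_mul] }

/-- The presheaf quotient of `Y × Z°` by the diagonal operation of `G`. Its associated sheaf is the
contracted product of `Y` and `Z°` over `G`. -/
def orbitPresheaf (Y Z : Torsor J G) : Cᵒᵖ ⥤ Type w where
  obj U := Quotient (orbitSetoid Y Z U.unop)
  map {U V} f := ↾(Quotient.map
    (fun p => (Y.Y.obj.map f p.1, Z.Y.obj.map f p.2)) (by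
      rintro p _ ⟨g, rfl⟩
      refine ⟨G.obj.map f g, ?_⟩
      have h1 := Y.map_act f.unop p.1 g
      have h2 := Z.map_act f.unop p.2 g
      simp only [Torsor.invAct, inv_inv]
      exact Prod.ext h1 h2))
  map_id U := by
    ext q
    induction q using Quotient.inductionOn with
    | h p => simp
  map_comp f g := by
    ext q
    induction q using Quotient.inductionOn with
    | h p => simp

/-- The class `[y, z]` of a pair of sections. -/
def orbitMk (Y Z : Torsor J G) {U : C} (y : Y.Y.obj.obj (op U)) (z : Z.Y.obj.obj (op U)) :
    (orbitPresheaf Y Z).obj (op U) :=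
  Quotient.mk (orbitSetoid Y Z U) (y, z)

end Contracted

section Fibred

variable (K : GrothendieckTopology 𝒮) (𝒳 : BasedCategory.{v₁, u₁} 𝒮)

/-- The structure morphism of a category over `𝒮`, as a `1`-morphism over `𝒮`. -/
def structureMorphism : BasedFunctor 𝒳 (baseCategory 𝒮) where
  toFunctor := 𝒳.p
  w := Functor.comp_id _

instance [IsFibredInGroupoids 𝒳] : 𝒳.p.IsContinuous (inheritedTopology K 𝒳) K := by
  have h := isContinuous K (structureMorphism 𝒳)
  rwa [inheritedTopology_baseCategory] at h

instance [IsFibredInGroupoids 𝒳] : 𝒳.p.IsCocontinuous (inheritedTopology K 𝒳) K := by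
  have h := isCocontinuous K (structureMorphism 𝒳)
  rwa [inheritedTopology_baseCategory] at h

variable {K}

/-- The pull-back to `𝒳` of a sheaf of groups on the base. -/
def groupOn [IsFibredInGroupoids 𝒳] (G : Sheaf K GrpCat.{w}) :
    Sheaf (inheritedTopology K 𝒳) GrpCat.{w} :=
  (𝒳.p.sheafPushforwardContinuous GrpCat.{w} (inheritedTopology K 𝒳) K).obj G

/-- The category of `G`-torsors over `𝒳`, where `G` is a sheaf of groups on the base. -/
abbrev TorsorOver [IsFibredInGroupoids 𝒳] (G : Sheaf K GrpCat.{w}) :=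
  Torsor (inheritedTopology K 𝒳) (groupOn 𝒳 G)

/-- The set of isomorphism classes of `G`-torsors over `𝒳`. -/
abbrev H1Over [IsFibredInGroupoids 𝒳] (G : Sheaf K GrpCat.{w}) :=
  Torsor.H1 (inheritedTopology K 𝒳) (groupOn 𝒳 G)

/-- Pull-back to `𝒳` of torsors over the base. -/
def baseTorsor [IsFibredInGroupoids 𝒳] (G : Sheaf K GrpCat.{w}) : Torsor K G ⥤ TorsorOver 𝒳 G :=
  Torsor.pullback 𝒳.p (Iso.refl _)

/-- Pull-back to `𝒳` of classes of torsors over the base. -/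
def baseClass [IsFibredInGroupoids 𝒳] (G : Sheaf K GrpCat.{w}) : Torsor.H1 K G → H1Over 𝒳 G :=
  Torsor.H1.pullback 𝒳.p (Iso.refl _)

variable {𝒳} {𝒜 : BasedCategory.{v₂, u₂} 𝒮} [IsFibredInGroupoids 𝒜] [IsFibredInGroupoids 𝒳]

/-- For a `1`-morphism `x : 𝒜 → 𝒳` over `𝒮`, the pull-back by `x` of the group `G` on `𝒳` is the
group `G` on `𝒜`. -/
def groupIso (G : Sheaf K GrpCat.{w}) (x : BasedFunctor 𝒜 𝒳) :
    (groupOn 𝒜 G).obj ≅ x.toFunctor.op ⋙ (groupOn 𝒳 G).obj :=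
  NatIso.ofComponents (fun a => G.obj.mapIso (eqToIso (x.w_obj a.unop)).op) (by
    intro a b f
    have h : 𝒳.p.map (x.map f.unop) = eqToHom (x.w_obj b.unop) ≫ 𝒜.p.map f.unop ≫
      eqToHom (x.w_obj a.unop).symm := by simpa using congr_hom x.w f.unop
    change G.obj.map (𝒜.p.map f.unop).op ≫ G.obj.map (eqToHom (x.w_obj b.unop)).op =
      G.obj.map (eqToHom (x.w_obj a.unop)).op ≫ G.obj.map (𝒳.p.map (x.map f.unop)).op
    rw [← G.obj.map_comp, ← G.obj.map_comp, ← op_comp, ← op_comp, h]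
    simp)

/-- The evaluation `A(x)` of a class `A` of torsors over `𝒳` at an `𝒜`-point `x` of `𝒳`. -/
def evalClass {G : Sheaf K GrpCat.{w}} (A : H1Over 𝒳 G) (x : BasedFunctor 𝒜 𝒳) : H1Over 𝒜 G :=
  Torsor.H1.pullback x.toFunctor (groupIso G x) A

/-- The obstruction `𝒳(𝒜)^A` given by a class `A`: the full subcategory of `𝒳(𝒜)` of the points `x`
such that `A(x)` comes from the base. -/
def obstruction (𝒜 : BasedCategory.{v₂, u₂} 𝒮) [IsFibredInGroupoids 𝒜] {G : Sheaf K GrpCat.{w}}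
    (A : H1Over 𝒳 G) : ObjectProperty (BasedFunctor 𝒜 𝒳) :=
  fun x => evalClass A x ∈ Set.range (baseClass 𝒜 G)

/-- The intersection of the obstructions given by all classes of `G`-torsors over `𝒳`. -/
def obstructionH1 (𝒜 : BasedCategory.{v₂, u₂} 𝒮) [IsFibredInGroupoids 𝒜]
    (𝒳 : BasedCategory.{v₁, u₁} 𝒮) [IsFibredInGroupoids 𝒳] (G : Sheaf K GrpCat.{w}) :
    ObjectProperty (BasedFunctor 𝒜 𝒳) :=
  ⨅ A : H1Over 𝒳 G, obstruction 𝒜 A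

/-- `f(𝒴(𝒜))`: the essential image of `𝒴(𝒜) → 𝒳(𝒜)`, `y ↦ f ∘ y`. -/
def imagePoints (𝒜 : BasedCategory.{v₂, u₂} 𝒮) {𝒳 : BasedCategory.{v₁, u₁} 𝒮}
    {𝒴 : BasedCategory.{v₃, u₃} 𝒮} (f : BasedFunctor 𝒴 𝒳) :
    ObjectProperty (BasedFunctor 𝒜 𝒳) :=
  fun x => ∃ y : BasedFunctor 𝒜 𝒴, Nonempty (y.comp f ≅ x)

section Associated

variable (𝒳 : BasedCategory.{v₁, u₁} 𝒮) (P : 𝒳.objᵒᵖ ⥤ Type w)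

/-- The objects of the category over `𝒳` associated to a presheaf of sets `P` on `𝒳`: pairs of an
object of `𝒳` and a section of `P` over it. -/
structure AssociatedObj where
  /-- the object of `𝒳` -/
  base : 𝒳.obj
  /-- the section of `P` -/
  sec : P.obj (op base)

instance : Category (AssociatedObj 𝒳 P) where
  Hom s t := {f : s.base ⟶ t.base // P.map f.op t.sec = s.sec}
  id s := ⟨𝟙 _, by simp⟩
  comp f g := ⟨f.1 ≫ g.1, by rw [op_comp, Functor.map_comp_apply, g.2, f.2]⟩

/-- The category fibred in sets over `𝒳` associated to a presheaf of sets `P` on `𝒳`, considered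
as a category over `𝒮`. -/
def associated : BasedCategory.{v₁, max u₁ w} 𝒮 where
  obj := AssociatedObj 𝒳 P
  p :=
    { obj := fun s => 𝒳.p.obj s.base
      map := fun {s t} (f : {f : s.base ⟶ t.base // P.map f.op t.sec = s.sec}) => 𝒳.p.map f.1
      map_id := fun _ => 𝒳.p.map_id _
      map_comp := fun _ _ => 𝒳.p.map_comp _ _ }

/-- The projection of the associated fibred category to `𝒳`. -/
def associatedProj : BasedFunctor (associated 𝒳 P) 𝒳 where
  obj s := AssociatedObj.base s
  map f := Subtype.val f
  map_id _ := rfl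
  map_comp _ _ := rfl
  w := rfl

end Associated

/-- A twist `f^σ : 𝒴^σ → 𝒳` of the `G`-torsor `Y` over `𝒳` by the Cech class `σ` of the base: a
torsor under a group `G^σ` isomorphic to the pull-back of `ad(Z)`, isomorphic to the contracted
product of `Y` with the inverse of the pull-back of `Z`, where `Z` is a torsor representing `σ`. -/
structure Twist {G : Sheaf K GrpCat.{w}} (Y : TorsorOver 𝒳 G) {T : 𝒮} {hT : Limits.IsTerminal T}
    (σ : CechH1 G hT) where
  /-- a torsor over the base representing `σ` -/
  Z : Torsor K G
  represents : Z.Represents σ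
  /-- the twisted group -/
  grp : Sheaf (inheritedTopology K 𝒳) GrpCat.{w}
  /-- the isomorphism of the twisted group with the pull-back of the adjoint group of `Z` -/
  grpEquiv : ∀ x : 𝒳.obj, grp.obj.obj (op x) ≃* Z.ad.obj (op (𝒳.p.obj x))
  grpEquiv_map : ∀ {x y : 𝒳.obj} (f : y ⟶ x) (h : grp.obj.obj (op x)),
    grpEquiv y (grp.obj.map f.op h) = Z.ad.map (𝒳.p.map f).op (grpEquiv x h)
  /-- the twisted torsor -/
  torsor : Torsor (inheritedTopology K 𝒳) grp
  /-- the quotient map from the presheaf of orbits, exhibiting the twisted torsor as its associated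
  sheaf, i.e. as the quotient sheaf of `Y × Z°` by the diagonal operation of `G` -/
  proj : orbitPresheaf Y ((baseTorsor 𝒳 G).obj Z) ⟶ torsor.Y.obj
  isLocallyInjective : Presheaf.IsLocallyInjective (inheritedTopology K 𝒳) proj
  isLocallySurjective : Presheaf.IsLocallySurjective (inheritedTopology K 𝒳) proj
  /-- the right action of the twisted group: `[y, z] h = [y, h⁻¹ z]` -/
  proj_act : ∀ {x : 𝒳.obj} (y : Y.Y.obj.obj (op x)) (z : Z.Y.obj.obj (op (𝒳.p.obj x)))
    (h : grp.obj.obj (op x)),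
    torsor.act (proj.app (op x) (orbitMk Y ((baseTorsor 𝒳 G).obj Z) y z)) h =
      proj.app (op x) (orbitMk Y ((baseTorsor 𝒳 G).obj Z) y (Z.adAct (grpEquiv x h)⁻¹ z))

/-- The full subcategory `f^σ(𝒴^σ(𝒜))` of `𝒳(𝒜)`, where `f^σ : 𝒴^σ → 𝒳` is a twist. -/
def Twist.points {G : Sheaf K GrpCat.{w}} {Y : TorsorOver 𝒳 G} {T : 𝒮}
    {hT : Limits.IsTerminal T} {σ : CechH1 G hT} (t : Twist Y σ)
    (𝒜 : BasedCategory.{v₂, u₂} 𝒮) : ObjectProperty (BasedFunctor 𝒜 𝒳) :=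
  imagePoints 𝒜 (associatedProj 𝒳 t.torsor.Y.obj)

end Fibred

section Schemes

open AlgebraicGeometry

/-- The two topologies under consideration. -/
inductive TopologyKind
  | etale
  | fppf

/-- The big etale or fppf topology on the category `Sch/S` of `S`-schemes. -/
def TopologyKind.topology (τ : TopologyKind) (S : Scheme.{u}) : GrothendieckTopology (Over S) :=
  match τ with
  | .etale => Scheme.etaleTopology.over S
  | .fppf => Scheme.fppfTopology.over S

/-- The first Cech cohomology of the big site `(Sch/S)_τ`, whose final object is `S`. -/
abbrev CechH1Over {S : Scheme.{u}} {τ : TopologyKind} (G : Sheaf (τ.topology S) GrpCat.{w}) :=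
  CechH1 G (Over.mkIdTerminal (X := S))

/-- The descent category `𝒳(𝒜)^desc`: the intersection of the obstructions given by all classes of
torsors under all fppf sheaves of groups on the base. -/
def descentCategory {S : Scheme.{u}} (𝒜 : BasedCategory.{v₂, u₂} (Over S))
    [IsFibredInGroupoids 𝒜] (𝒳 : BasedCategory.{v₁, u₁} (Over S)) [IsFibredInGroupoids 𝒳] :
    ObjectProperty (BasedFunctor 𝒜 𝒳) :=
  ⨅ G : Sheaf (TopologyKind.fppf.topology S) GrpCat.{w}, obstructionH1 𝒜 𝒳 G

end Schemes

end DescentByTorsors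

open DescentByTorsors AlgebraicGeometry

/-!
The argument works over any base site `(𝒮, K)` with a final object and uses only that `𝒳` and `𝒜`
are fibred in groupoids.

A section over `x` of the contracted product `Y ×^G Z°` is an equivariant map `Z → Y` above `x`:
the orbit `[y, z]` is the map with `z ↦ y`. This gives the twists: `Twist` asks for a sheaf
associated to the presheaf of orbits, and `twistedTorsor` takes the sheaf of equivariant maps, on
which `ad(Z) = Aut_G(Z)` acts simply transitively by composition. That it and `ad(Z)` are sheaves
is `isSheaf_homPresheaf`. The torsor `Z` is built from a cocycle `g` as the sheaf of families of
coordinates `h` with `h_I = g_{IJ} h_J` (`cocycleTorsor`).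

For an arbitrary twist with torsor `Z`, the pairing `(y, z) ↦ [y, z]` still makes the sections of
the twist correspond to those of `Y` as soon as a section `z` of `Z` is given
(`Twist.pairMk_injective`, `Twist.exists_pairMk_eq`). A point `x` of `𝒳` over `𝒜` lifts to the
twist if and only if the pull-back by `x` of the twisted torsor has a global section
(`imagePoints_associatedProj_iff`), which thus amounts to an equivariant map `q^* Z → x^* Y`, i.e.
to an isomorphism of torsors (`Twist.exists_hom_of_points`, `Twist.points_of_hom`). As every torsor
over the base represents a Čech class and a class determines the torsor up to isomorphism
(`Torsor.exists_class`, `Torsor.Represents.nonempty_iso`), `x` lifts to one of the twists if and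
only if `x^* Y` comes from the base. For `𝒜 = 𝒮` all torsors come from the base. The statement on
the descent category follows by intersecting over all `G` and `Y`.
-/

namespace DescentByTorsors

/-! ### Gluing sections of sheaves of sets -/

section Gluing

variable {C : Type u₁} [Category.{v₁} C] {J : GrothendieckTopology C} {P : Cᵒᵖ ⥤ Type w}

lemma eq_of_locally_eq (hP : Presheaf.IsSheaf J P) {U : C} {R : Sieve U} (hR : R ∈ J U)
    {s t : P.obj (op U)} (h : ∀ ⦃V : C⦄ (f : V ⟶ U), R f → P.map f.op s = P.map f.op t) :
    s = t :=
  (hP.isSheafFor R hR).isSeparatedFor.ext fun _ f hf => h f hf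

lemma exists_amalgamation (hP : Presheaf.IsSheaf J P) {U : C} {R : Sieve U} (hR : R ∈ J U)
    (s : ∀ ⦃V : C⦄ (f : V ⟶ U), R f → P.obj (op V))
    (hs : ∀ ⦃V W : C⦄ (f : V ⟶ U) (g : W ⟶ V) (hf : R f),
      P.map g.op (s f hf) = s (g ≫ f) (R.downward_closed hf g)) :
    ∃ t : P.obj (op U), ∀ ⦃V : C⦄ (f : V ⟶ U) (hf : R f), P.map f.op t = s f hf := by
  obtain ⟨t, ht, -⟩ := hP.isSheafFor R hR (fun V f hf => s f hf)
    ((Presieve.compatible_iff_sieveCompatible _).2 fun V W f g hf => (hs f g hf).symm)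
  exact ⟨t, fun V f hf => ht f hf⟩

/-- If a property of sections is stable under restriction and satisfied by at most one section over
each object above `U`, then local sections with the property glue. -/
lemma exists_of_locally_existsUnique (hP : Presheaf.IsSheaf J P) {U : C}
    (r : ∀ ⦃V : C⦄, (V ⟶ U) → P.obj (op V) → Prop)
    (map : ∀ ⦃V W : C⦄ (f : V ⟶ U) (g : W ⟶ V) (s : P.obj (op V)), r f s →
      r (g ≫ f) (P.map g.op s))
    (unique : ∀ ⦃V : C⦄ (f : V ⟶ U) (s t : P.obj (op V)), r f s → r f t → s = t)
    {R : Sieve U} (hR : R ∈ J U) (h : ∀ ⦃V : C⦄ (f : V ⟶ U), R f → ∃ s, r f s) :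
    ∃ t : P.obj (op U), ∀ ⦃V : C⦄ (f : V ⟶ U), R f → r f (P.map f.op t) := by
  choose s hs using h
  obtain ⟨t, ht⟩ := exists_amalgamation hP hR s fun V W f g hf =>
    unique _ _ _ (map f g _ (hs f hf)) (hs _ _)
  exact ⟨t, fun V f hf => by rw [ht f hf]; exact hs f hf⟩

lemma isSheaf_forget (G : Sheaf J GrpCat.{w}) :
    Presheaf.IsSheaf J (G.obj ⋙ forget GrpCat.{w}) :=
  Presheaf.isSheaf_comp_of_isSheaf J G.obj (forget GrpCat.{w}) G.property

lemma map_comp_op (P : Cᵒᵖ ⥤ Type w) {U V W : C} (f : V ⟶ U) (g : W ⟶ V)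
    (s : P.obj (op U)) : P.map (g ≫ f).op s = P.map g.op (P.map f.op s) := by
  rw [op_comp, Functor.map_comp_apply]

lemma map_id_op (P : Cᵒᵖ ⥤ Type w) {U : C} (s : P.obj (op U)) :
    P.map (𝟙 U).op s = s := by
  simp

end Gluing

/-! ### Sheaves of homomorphisms with a local property -/

section HomPresheaf

variable {C : Type u₁} [Category.{v₁} C] {J : GrothendieckTopology C}

/-- The presheaf whose sections over `U` are the morphisms of presheaves from `F|_{C/U}` to
`P|_{C/U}` all of whose components satisfy the condition `c`. -/
def homPresheaf (F : Cᵒᵖ ⥤ Type u₂) (P : Cᵒᵖ ⥤ Type u₃)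
    (c : ∀ V : C, (F.obj (op V) → P.obj (op V)) → Prop) :
    Cᵒᵖ ⥤ Type (max u₁ v₁ u₂ u₃) where
  obj U := {φ : ∀ V : C, (V ⟶ U.unop) → F.obj (op V) → P.obj (op V) //
    (∀ (V W : C) (f : V ⟶ U.unop) (k : W ⟶ V) (s : F.obj (op V)),
      P.map k.op (φ V f s) = φ W (k ≫ f) (F.map k.op s)) ∧
    ∀ (V : C) (f : V ⟶ U.unop), c V (φ V f)}
  map {U U'} g := ↾(fun φ => ⟨fun V f => φ.1 V (f ≫ g.unop),
    fun V W f k s => by simpa using φ.2.1 V W (f ≫ g.unop) k s,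
    fun V f => φ.2.2 V (f ≫ g.unop)⟩)
  map_id U := by
    ext φ : 3
    refine Subtype.ext (funext fun V => funext fun f => ?_)
    change φ.1 V (f ≫ 𝟙 _) = φ.1 V f
    rw [Category.comp_id]
  map_comp g h := by
    ext φ : 3
    refine Subtype.ext (funext fun V => funext fun f => ?_)
    change φ.1 V (f ≫ h.unop ≫ g.unop) = φ.1 V ((f ≫ h.unop) ≫ g.unop)
    rw [Category.assoc]

/-- Morphisms into a sheaf extend uniquely from a covering sieve, so they form a sheaf; the
condition `c` may be imposed if it can be tested locally. -/
lemma isSheaf_homPresheaf {F : Cᵒᵖ ⥤ Type u₂} {P : Cᵒᵖ ⥤ Type u₃}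
    {c : ∀ V : C, (F.obj (op V) → P.obj (op V)) → Prop} (hP : Presheaf.IsSheaf J P)
    (hc : ∀ (V : C) (R : Sieve V) (_ : R ∈ J V) (h : F.obj (op V) → P.obj (op V)),
      (∀ ⦃W : C⦄ (g : W ⟶ V), R g → ∃ k : F.obj (op W) → P.obj (op W), c W k ∧
        ∀ s, P.map g.op (h s) = k (F.map g.op s)) → c V h) :
    Presheaf.IsSheaf J (homPresheaf F P c) := by
  rw [isSheaf_iff_isSheaf_of_type]
  intro U R hR
  refine Presieve.IsSeparatedFor.isSheafFor ?_ ?_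
  · rintro x φ φ' h h'
    refine Subtype.ext (funext fun V => funext fun f => funext fun s => ?_)
    refine eq_of_locally_eq hP (J.pullback_stable f hR) fun W k hk => ?_
    have e := congrArg (fun ψ => ψ.1 W (𝟙 W) (F.map k.op s)) ((h _ hk).trans (h' _ hk).symm)
    change φ.1 W (𝟙 W ≫ k ≫ f) _ = φ'.1 W (𝟙 W ≫ k ≫ f) _ at e
    rw [Category.id_comp] at e
    exact (φ.2.1 V W f k s).trans (e.trans (φ'.2.1 V W f k s).symm)
  · intro x hx
    have hx' := (Presieve.compatible_iff_sieveCompatible _).1 hx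
    -- A compatible family amounts to its values at the identities of the members of the sieve.
    obtain ⟨ev, hev⟩ : ∃ ev : ∀ ⦃W : C⦄ (g : W ⟶ U), R g → F.obj (op W) → P.obj (op W),
        ∀ ⦃V W : C⦄ (f : V ⟶ U) (hf : R f) (k : W ⟶ V),
          (x f hf).1 W k = ev (k ≫ f) (R.downward_closed hf k) := by
      refine ⟨fun W g hg => (x g hg).1 W (𝟙 W), fun V W f hf k => ?_⟩
      have e : (x (k ≫ f) (R.downward_closed hf k)).1 W (𝟙 W) = (x f hf).1 W (𝟙 W ≫ k) :=
        congrArg (fun ψ => ψ.1 W (𝟙 W)) (hx' f k hf)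
      exact ((congrArg _ (Category.id_comp k)).symm.trans e.symm)
    have evmap : ∀ ⦃V W : C⦄ (g : V ⟶ U) (hg : R g) (k : W ⟶ V) (s : F.obj (op V)),
        P.map k.op (ev g hg s) = ev (k ≫ g) (R.downward_closed hg k) (F.map k.op s) := by
      intro V W g hg k s
      have e := (x g hg).2.1 V W (𝟙 V) k s
      rw [hev, hev] at e
      simpa only [Category.id_comp, Category.comp_id] using e
    have key : ∀ (V : C) (f : V ⟶ U) (s : F.obj (op V)), ∃ t : P.obj (op V),
        ∀ ⦃W : C⦄ (k : W ⟶ V) (hk : R (k ≫ f)), P.map k.op t = ev (k ≫ f) hk (F.map k.op s) := by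
      intro V f s
      refine exists_amalgamation hP (J.pullback_stable f hR)
        (fun W k hk => ev (k ≫ f) hk (F.map k.op s)) fun W W' k l hk => ?_
      refine (evmap _ (show R (k ≫ f) from hk) l _).trans ?_
      simp only [Category.assoc, map_comp_op]
    choose φ hφ using key
    have nat : ∀ (V W : C) (f : V ⟶ U) (k : W ⟶ V) (s : F.obj (op V)),
        P.map k.op (φ V f s) = φ W (k ≫ f) (F.map k.op s) := by
      intro V W f k s
      refine eq_of_locally_eq hP (J.pullback_stable (k ≫ f) hR) fun W' l hl => ?_
      have hl' : R (l ≫ k ≫ f) := hl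
      rw [hφ W (k ≫ f) _ l hl', ← map_comp_op, hφ V f s (l ≫ k) (by simpa using hl')]
      simp only [Category.assoc, map_comp_op]
    refine ⟨⟨φ, nat, ?_⟩, ?_⟩
    · intro V f
      refine hc V _ (J.pullback_stable f hR) _ fun W k hk => ?_
      replace hk : R (k ≫ f) := hk
      refine ⟨_, (x (k ≫ f) hk).2.2 W (𝟙 W), fun s => ?_⟩
      rw [hev]
      simpa only [Category.id_comp] using hφ V f s k hk
    · intro V f hf
      refine Subtype.ext (funext fun W => funext fun k => funext fun s => ?_)
      change φ W (k ≫ f) s = (x f hf).1 W k s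
      have hk := R.downward_closed hf k
      have e := hφ W (k ≫ f) s (𝟙 W) (by simpa using hk)
      rw [hev]
      simpa only [map_id_op, Category.id_comp] using e

end HomPresheaf

/-! ### Elementary properties of torsors -/

namespace Torsor

variable {C : Type u₁} [Category.{v₁} C] {J : GrothendieckTopology C} {G : Sheaf J GrpCat.{w}}

section Division

variable (Y : Torsor J G)

/-- The unique section `g` of `G` with `y g = y'`. -/
noncomputable def div {U : C} (y y' : Y.Y.obj.obj (op U)) : G.obj.obj (op U) :=
  ((Y.bijective U).2 (y, y')).choose.2

lemma act_div {U : C} (y y' : Y.Y.obj.obj (op U)) : Y.act y (Y.div y y') = y' := by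
  have h := ((Y.bijective U).2 (y, y')).choose_spec
  have h1 := congrArg Prod.fst h
  have h2 := congrArg Prod.snd h
  dsimp at h1 h2
  rwa [h1] at h2

lemma act_injective {U : C} {y : Y.Y.obj.obj (op U)} {g h : G.obj.obj (op U)}
    (e : Y.act y g = Y.act y h) : g = h :=
  congrArg Prod.snd ((Y.bijective U).1 (a₁ := (y, g)) (a₂ := (y, h)) (Prod.ext rfl e))

lemma div_eq {U : C} {y y' : Y.Y.obj.obj (op U)} {g : G.obj.obj (op U)} (e : Y.act y g = y') :
    Y.div y y' = g :=
  Y.act_injective ((Y.act_div y y').trans e.symm)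

lemma div_self {U : C} (y : Y.Y.obj.obj (op U)) : Y.div y y = 1 :=
  Y.div_eq (Y.act_one y)

lemma div_act {U : C} (y y' : Y.Y.obj.obj (op U)) (g : G.obj.obj (op U)) :
    Y.div y (Y.act y' g) = Y.div y y' * g :=
  Y.div_eq (by rw [Y.act_mul, act_div])

lemma div_mul_div {U : C} (y y' y'' : Y.Y.obj.obj (op U)) :
    Y.div y y' * Y.div y' y'' = Y.div y y'' :=
  (Y.div_eq (by rw [Y.act_mul, act_div, act_div])).symm

lemma map_div {U V : C} (f : V ⟶ U) (y y' : Y.Y.obj.obj (op U)) :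
    G.obj.map f.op (Y.div y y') = Y.div (Y.Y.obj.map f.op y) (Y.Y.obj.map f.op y') :=
  (Y.div_eq (by rw [← Y.map_act, act_div])).symm

end Division

/-- An equivariant map between the sections of two torsors is bijective if the source is
inhabited. -/
lemma bijective_of_equivariant (Y Z : Torsor J G) {U : C} (y : Y.Y.obj.obj (op U))
    (φ : Y.Y.obj.obj (op U) → Z.Y.obj.obj (op U)) (hφ : ∀ y g, φ (Y.act y g) = Z.act (φ y) g) :
    Function.Bijective φ := by
  refine ⟨fun y₁ y₂ e => ?_, fun z => ⟨Y.act y (Z.div (φ y) z), ?_⟩⟩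
  · have h := hφ y₁ (Y.div y₁ y₂)
    rw [act_div, ← e] at h
    have h1 := Z.act_injective ((Z.act_one (φ y₁)).trans h)
    rw [← Y.act_div y₁ y₂, ← h1, Y.act_one]
  · rw [hφ, act_div]

/-- A compatible family of equivariant maps is bijective, also over objects over which the source
has no section a priori. -/
lemma bijective_of_equivariant_family (Y Z : Torsor J G) {U : C}
    (φ : ∀ V : C, (V ⟶ U) → Y.Y.obj.obj (op V) → Z.Y.obj.obj (op V))
    (nat : ∀ (V W : C) (f : V ⟶ U) (k : W ⟶ V) (y : Y.Y.obj.obj (op V)),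
      Z.Y.obj.map k.op (φ V f y) = φ W (k ≫ f) (Y.Y.obj.map k.op y))
    (hφ : ∀ V f y g, φ V f (Y.act y g) = Z.act (φ V f y) g) (V : C) (f : V ⟶ U) :
    Function.Bijective (φ V f) := by
  refine ⟨fun y₁ y₂ e => (bijective_of_equivariant Y Z y₁ _ (hφ V f)).1 e, fun z => ?_⟩
  obtain ⟨R, hR, h⟩ := Y.locally_nonempty V
  obtain ⟨y, hy⟩ := exists_of_locally_existsUnique Y.Y.property
    (fun W k y => φ W (k ≫ f) y = Z.Y.obj.map k.op z)
    (fun W W' k l y e => by rw [Category.assoc, ← nat, e, ← map_comp_op])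
    (fun W k y₁ y₂ e₁ e₂ =>
      (bijective_of_equivariant Y Z y₁ _ (hφ W (k ≫ f))).1 (e₁.trans e₂.symm)) hR
    (fun W k hk => (bijective_of_equivariant Y Z (h k hk).some _ (hφ W (k ≫ f))).2 _)
  refine ⟨y, eq_of_locally_eq Z.Y.property hR fun W k hk => ?_⟩
  rw [nat, hy k hk]

/-- Every morphism of torsors is an isomorphism. -/
lemma nonempty_iso {Y Z : Torsor J G} (f : Y ⟶ Z) : Nonempty (Y ≅ Z) := by
  have hb (U : C) : Function.Bijective (f.hom.hom.app (op U)) :=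
    bijective_of_equivariant_family Y Z (fun V (_ : V ⟶ U) => f.hom.hom.app (op V))
      (fun V W _ k y => (NatTrans.naturality_apply f.hom.hom k.op y).symm)
      (fun V _ y g => f.hom_act y g) U (𝟙 U)
  have : ∀ U, IsIso (f.hom.hom.app U) := fun U => (isIso_iff_bijective _).2 (hb U.unop)
  have h1 : IsIso f.hom.hom := NatIso.isIso_of_isIso_app _
  have h2 : IsIso ((sheafToPresheaf J (Type w)).map f.hom) := h1
  have h3 : IsIso f.hom := isIso_of_reflects_iso _ (sheafToPresheaf J (Type w))
  have e1 : ∀ (U : C) z, f.hom.hom.app (op U) ((inv f.hom).hom.app (op U) z) = z := fun U z => by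
    simp
  refine ⟨⟨f, ⟨inv f.hom, fun {U} z g => (hb U).1 ?_⟩, ?_, ?_⟩⟩
  · rw [f.hom_act, e1, e1]
  · exact Hom.ext (IsIso.hom_inv_id f.hom)
  · exact Hom.ext (IsIso.inv_hom_id f.hom)

/-- A sheaf of sets with an action of `G` is a torsor if, locally, it has sections and the action is
simply transitive. -/
def ofLocally (Y : Sheaf J (Type w))
    (act : ∀ {U : C}, Y.obj.obj (op U) → G.obj.obj (op U) → Y.obj.obj (op U))
    (act_one : ∀ {U : C} (y : Y.obj.obj (op U)), act y 1 = y)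
    (act_mul : ∀ {U : C} (y : Y.obj.obj (op U)) (g h : G.obj.obj (op U)),
      act y (g * h) = act (act y g) h)
    (map_act : ∀ {U V : C} (f : V ⟶ U) (y : Y.obj.obj (op U)) (g : G.obj.obj (op U)),
      Y.obj.map f.op (act y g) = act (Y.obj.map f.op y) (G.obj.map f.op g))
    (h : ∀ U : C, ∃ R ∈ J U, ∀ ⦃V : C⦄ (f : V ⟶ U), R f → Nonempty (Y.obj.obj (op V)) ∧
      ∀ y y' : Y.obj.obj (op V), ∃! g, act y g = y') : Torsor J G where
  Y := Y
  act := act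
  act_one := act_one
  act_mul := act_mul
  map_act := map_act
  locally_nonempty U := by
    obtain ⟨R, hR, h⟩ := h U
    exact ⟨R, hR, fun V f hf => (h f hf).1⟩
  bijective U := by
    have inj {V : C} (y : Y.obj.obj (op V)) (g g' : G.obj.obj (op V)) (e : act y g = act y g') :
        g = g' := by
      obtain ⟨R, hR, h⟩ := h V
      refine eq_of_locally_eq (isSheaf_forget G) hR fun W k hk => ?_
      exact ((h k hk).2 (Y.obj.map k.op y) (Y.obj.map k.op (act y g))).unique (map_act k y g).symm
        ((map_act k y g').symm.trans (congrArg _ e.symm))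
    refine ⟨?_, ?_⟩
    · rintro ⟨y, g⟩ ⟨y', g'⟩ e
      obtain rfl : y = y' := congrArg Prod.fst e
      exact Prod.ext rfl (inj y g g' (congrArg Prod.snd e))
    · rintro ⟨y, y'⟩
      obtain ⟨R, hR, h⟩ := h U
      obtain ⟨g, hg⟩ := exists_of_locally_existsUnique (isSheaf_forget G)
        (fun V f g => act (Y.obj.map f.op y) g = Y.obj.map f.op y')
        (fun V W f k g e => by
          refine Eq.trans ?_ ((congrArg (Y.obj.map k.op) e).trans (map_comp_op _ _ _ _).symm)
          rw [map_act, ← map_comp_op]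
          rfl)
        (fun V f g g' e e' => inj _ _ _ (e.trans e'.symm)) hR
        (fun V f hf => ((h f hf).2 _ _).exists)
      refine ⟨(y, g), Prod.ext rfl (eq_of_locally_eq Y.property hR fun V f hf => ?_)⟩
      exact (map_act _ _ _).trans (hg f hf)

end Torsor

/-! ### The sheaf of equivariant maps and the adjoint group -/

namespace Torsor

variable {C : Type u₁} [Category.{v₁} C] {J : GrothendieckTopology C} {G : Sheaf J GrpCat.{w}}

/-- The presheaf of equivariant maps from `Z` to `Y`. -/
abbrev equivariantMaps (Z Y : Torsor J G) : Cᵒᵖ ⥤ Type (max u₁ v₁ w) :=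
  homPresheaf Z.Y.obj Y.Y.obj fun _ φ => ∀ z g, φ (Z.act z g) = Y.act (φ z) g

lemma isSheaf_equivariantMaps (Z Y : Torsor J G) :
    Presheaf.IsSheaf J (equivariantMaps Z Y) := by
  refine isSheaf_homPresheaf Y.Y.property fun V R hR φ h z g => ?_
  refine eq_of_locally_eq Y.Y.property hR fun W k hk => ?_
  obtain ⟨ψ, hψ, e⟩ := h k hk
  rw [e, Z.map_act, hψ, Y.map_act, e]

lemma bijective_equivariantMaps {Z Y : Torsor J G} {U : Cᵒᵖ} (φ : (equivariantMaps Z Y).obj U)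
    (V : C) (f : V ⟶ U.unop) : Function.Bijective (φ.1 V f) :=
  bijective_of_equivariant_family Z Y φ.1 φ.2.1 φ.2.2 V f

/-- Sections of the adjoint group of `Z` are the equivariant maps from `Z` to itself, as these are
automatically bijective. -/
noncomputable def adIso (Z : Torsor J G) : Z.ad ⋙ forget GrpCat ≅ equivariantMaps Z Z :=
  NatIso.ofComponents (fun U => Equiv.toIso
    { toFun := fun (φ : Z.adSections U.unop) => ⟨fun V f => φ.1 V f, φ.2⟩
      invFun := fun φ => (⟨fun V f => Equiv.ofBijective (φ.1 V f) (bijective_equivariantMaps φ V f),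
        φ.2⟩ : Z.adSections U.unop)
      left_inv := fun φ => Subtype.ext (by funext V f; exact Equiv.ext fun _ => rfl)
      right_inv := fun φ => rfl }) (by intros; rfl)

lemma isSheaf_ad (Z : Torsor J G) : Presheaf.IsSheaf J Z.ad := by
  refine Presheaf.isSheaf_of_isSheaf_comp J Z.ad (forget GrpCat) ?_
  rw [Presheaf.isSheaf_of_iso_iff (adIso Z)]
  exact isSheaf_equivariantMaps Z Z

/-- An equivariant map is determined by its value at one section. -/
lemma equivariantMaps_ext {Z Y : Torsor J G} {U : C} (z : Z.Y.obj.obj (op U))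
    {φ ψ : (equivariantMaps Z Y).obj (op U)} (h : φ.1 U (𝟙 U) z = ψ.1 U (𝟙 U) z) : φ = ψ := by
  refine Subtype.ext (funext fun V => funext fun f => funext fun y => ?_)
  have key : φ.1 V f (Z.Y.obj.map f.op z) = ψ.1 V f (Z.Y.obj.map f.op z) := by
    have e1 := φ.2.1 U V (𝟙 U) f z
    have e2 := ψ.2.1 U V (𝟙 U) f z
    rw [Category.comp_id] at e1 e2
    rw [← e1, ← e2, h]
  rw [← Z.act_div (Z.Y.obj.map f.op z) y, φ.2.2 V f, ψ.2.2 V f, key]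

lemma ad_ext (Z : Torsor J G) {U : C} (z : Z.Y.obj.obj (op U))
    {φ ψ : Z.ad.obj (op U)} (h : Z.adAct φ z = Z.adAct ψ z) : φ = ψ := by
  have e : (adIso Z).hom.app (op U) φ = (adIso Z).hom.app (op U) ψ := equivariantMaps_ext z h
  refine Subtype.ext (funext fun V => funext fun f => Equiv.ext fun y => ?_)
  exact congrArg (fun χ => χ.1 V f y) e

/-- The equivariant map over `U` which maps `z` to `y`. -/
noncomputable def homOfPoints {Z Y : Torsor J G} {U : C} (z : Z.Y.obj.obj (op U))
    (y : Y.Y.obj.obj (op U)) : (equivariantMaps Z Y).obj (op U) :=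
  ⟨fun V f z' => Y.act (Y.Y.obj.map f.op y) (Z.div (Z.Y.obj.map f.op z) z'),
    fun V W f k z' => by
      simp only [Y.map_act, Z.map_div, map_comp_op],
    fun V f z' g => by simp only [Z.div_act, Y.act_mul]⟩

lemma homOfPoints_apply {Z Y : Torsor J G} {U : C} (z : Z.Y.obj.obj (op U))
    (y : Y.Y.obj.obj (op U)) : (homOfPoints z y).1 U (𝟙 U) z = y := by
  change Y.act (Y.Y.obj.map (𝟙 U).op y) (Z.div (Z.Y.obj.map (𝟙 U).op z) z) = y
  rw [map_id_op, map_id_op, div_self, act_one]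

/-- The automorphism over `U` which maps `z` to `z'`. -/
noncomputable def adOfPoints (Z : Torsor J G) {U : C} (z z' : Z.Y.obj.obj (op U)) :
    Z.ad.obj (op U) :=
  (adIso Z).inv.app (op U) (homOfPoints z z')

lemma adAct_adOfPoints (Z : Torsor J G) {U : C} (z z' : Z.Y.obj.obj (op U)) :
    Z.adAct (adOfPoints Z z z') z = z' :=
  homOfPoints_apply z z'

/-- The morphism from the presheaf of orbits to the sheaf of equivariant maps: `[y, z]` goes to the
equivariant map with `z ↦ y`. -/
noncomputable def orbitHom {G : Sheaf J GrpCat.{max w u₁ v₁}} (Y Z : Torsor J G) :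
    orbitPresheaf Y Z ⟶ equivariantMaps Z Y where
  app U := ↾(Quotient.lift (s := orbitSetoid Y Z U.unop)
    (fun p => homOfPoints (U := U.unop) p.2 p.1)
    (by
      rintro ⟨y, z⟩ _ ⟨g, rfl⟩
      refine equivariantMaps_ext z ?_
      have e := (homOfPoints (Z.act z g) (Y.act y g)).2.2 U.unop (𝟙 _) (Z.act z g) g⁻¹
      rw [homOfPoints_apply, ← Z.act_mul, ← Y.act_mul, mul_inv_cancel, Z.act_one, Y.act_one] at e
      rw [homOfPoints_apply]
      simpa [Torsor.invAct] using e.symm))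
  naturality U V f := by
    ext q : 3
    induction q using Quotient.inductionOn with
    | h p =>
      refine equivariantMaps_ext (Z.Y.obj.map f p.2) ?_
      refine (homOfPoints_apply _ _).trans ?_
      have e := (homOfPoints p.2 p.1).2.1 U.unop V.unop (𝟙 _) f.unop p.2
      rw [homOfPoints_apply, Category.comp_id] at e
      refine e.trans ?_
      change _ = (homOfPoints p.2 p.1).1 V.unop (𝟙 _ ≫ f.unop) _
      rw [Category.id_comp]
      rfl

instance isLocallyInjective_orbitHom {G : Sheaf J GrpCat.{max w u₁ v₁}} (Y Z : Torsor J G) :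
    Presheaf.IsLocallyInjective J (orbitHom.{w} Y Z) := by
  refine Presheaf.isLocallyInjective_of_injective _ _ fun U q q' e => ?_
  induction q using Quotient.inductionOn with | h p => ?_
  induction q' using Quotient.inductionOn with | h p' => ?_
  replace e : homOfPoints (U := U.unop) p.2 p.1 = homOfPoints p'.2 p'.1 := e
  refine Quotient.sound ⟨Z.div p.2 p'.2, Prod.ext ?_ ?_⟩
  · have e1 := (homOfPoints (U := U.unop) p.2 p.1).2.2 U.unop (𝟙 _) p.2 (Z.div p.2 p'.2)
    rw [act_div, homOfPoints_apply, e, homOfPoints_apply] at e1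
    exact e1
  · simp [Torsor.invAct, act_div]

instance isLocallySurjective_orbitHom {G : Sheaf J GrpCat.{max w u₁ v₁}} (Y Z : Torsor J G) :
    Presheaf.IsLocallySurjective J (orbitHom.{w} Y Z) where
  imageSieve_mem {U} φ := by
    obtain ⟨R, hR, h⟩ := Z.locally_nonempty U
    refine J.superset_covering (fun V f hf => ?_) hR
    obtain ⟨z⟩ := h f hf
    -- Where `Z` has a section `z`, the equivariant map `φ` is the image of `[φ z, z]`.
    exact ⟨orbitMk Y Z (φ.1 V f z) z, equivariantMaps_ext z ((homOfPoints_apply _ _).trans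
      (congrArg (fun k => φ.1 V k z) (Category.id_comp f).symm))⟩

end Torsor

/-! ### Existence of twists -/

section Twisted

variable {𝒮 : Type u₀} [Category.{v₀} 𝒮] {K : GrothendieckTopology 𝒮}
  {𝒳 : BasedCategory.{v₁, u₁} 𝒮} [IsFibredInGroupoids 𝒳]
  {G : Sheaf K GrpCat.{max w u₀ v₀ u₁ v₁}}

open _root_.DescentByTorsors.Torsor

/-- The contracted product of `Y` with the inverse of the pull-back of `Z`, realized as the sheaf of
equivariant maps from the pull-back of `Z` to `Y`. The adjoint group of `Z` acts by composition. -/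
noncomputable def twistedTorsor (Y : TorsorOver 𝒳 G) (Z : Torsor K G) :
    TorsorOver 𝒳 (⟨Z.ad, Z.isSheaf_ad⟩ : Sheaf K GrpCat.{max w u₀ v₀ u₁ v₁}) :=
  Torsor.ofLocally ⟨equivariantMaps ((baseTorsor 𝒳 G).obj Z) Y, isSheaf_equivariantMaps _ _⟩
    (act := fun {x} φ (h : Z.adSections (𝒳.p.obj x)) =>
      ⟨fun y f z => φ.1 y f (h.1 (𝒳.p.obj y) (𝒳.p.map f) z),
        fun y y' f k z => by
          refine (φ.2.1 y y' f k _).trans (congrArg (φ.1 y' (k ≫ f)) ?_)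
          refine (h.2.1 _ _ (𝒳.p.map f) (𝒳.p.map k) z).trans ?_
          rw [← 𝒳.p.map_comp]
          rfl,
        fun y f z g => (congrArg (φ.1 y f) (h.2.2 _ (𝒳.p.map f) z g)).trans (φ.2.2 y f _ _)⟩)
    (act_one := fun φ => rfl)
    (act_mul := fun φ g h => rfl)
    (map_act := fun {x x'} f φ h => by
      refine Subtype.ext (funext fun y => funext fun k => funext fun z => ?_)
      change φ.1 y (k ≫ f) (h.1 _ (𝒳.p.map (k ≫ f)) z) =
        φ.1 y (k ≫ f) (h.1 _ (𝒳.p.map k ≫ 𝒳.p.map f) z)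
      rw [𝒳.p.map_comp])
    (by
      intro x
      obtain ⟨R, hR, h⟩ := ((baseTorsor 𝒳 G).obj Z).locally_nonempty x
      obtain ⟨R', hR', h'⟩ := Y.locally_nonempty x
      refine ⟨R ⊓ R', (inheritedTopology K 𝒳).intersection_covering hR hR', fun x' f hf => ?_⟩
      obtain ⟨z⟩ := h f hf.1
      obtain ⟨y⟩ := h' f hf.2
      refine ⟨⟨homOfPoints z y⟩, fun φ ψ => ?_⟩
      -- In the action, the automorphism is evaluated at `𝒳.p.map (𝟙 x')` instead of an identity.
      have eval (χ : Z.adSections (𝒳.p.obj x')) :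
          φ.1 x' (𝟙 x') (χ.1 _ (𝒳.p.map (𝟙 x')) z) = φ.1 x' (𝟙 x') (χ.1 _ (𝟙 _) z) := by
        rw [𝒳.p.map_id]
      -- The automorphism `φ⁻¹ ψ` of `Z` is the one which maps `z` to `z' = φ⁻¹ (ψ z)`.
      obtain ⟨z', hz'⟩ := (bijective_equivariantMaps φ x' (𝟙 x')).2 (ψ.1 x' (𝟙 x') z)
      refine ⟨Z.adOfPoints z z', equivariantMaps_ext z ?_, fun χ hχ => ad_ext Z z ?_⟩
      · refine (eval _).trans (Eq.trans (congrArg (φ.1 x' (𝟙 x')) ?_) hz')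
        exact adAct_adOfPoints Z z z'
      · refine Eq.trans ?_ (adAct_adOfPoints Z z z').symm
        refine (bijective_equivariantMaps φ x' (𝟙 x')).1 ?_
        exact (eval χ).symm.trans ((congrArg (fun ω => ω.1 x' (𝟙 x') z) hχ).trans hz'.symm))

/-- Twists exist as soon as the class is represented by a torsor. -/
noncomputable def twistOfRepresents (Y : TorsorOver 𝒳 G) {T : 𝒮} {hT : Limits.IsTerminal T}
    {σ : CechH1 G hT} (Z : Torsor K G) (h : Z.Represents σ) : Twist Y σ where
  Z := Z
  represents := h
  grp := groupOn 𝒳 (⟨Z.ad, Z.isSheaf_ad⟩ : Sheaf K GrpCat.{max w u₀ v₀ u₁ v₁})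
  grpEquiv x := MulEquiv.refl _
  grpEquiv_map _ _ := rfl
  torsor := twistedTorsor.{w} Y Z
  proj := orbitHom.{max w u₀ v₀} Y _
  isLocallyInjective := isLocallyInjective_orbitHom.{max w u₀ v₀} Y _
  isLocallySurjective := isLocallySurjective_orbitHom.{max w u₀ v₀} Y _
  proj_act {x} y z h := by
    refine equivariantMaps_ext (Z := (baseTorsor 𝒳 G).obj Z) (Z.adAct h⁻¹ z) ?_
    refine Eq.trans ?_ (homOfPoints_apply (Z := (baseTorsor 𝒳 G).obj Z) _ y).symm
    refine Eq.trans ?_ (homOfPoints_apply (Z := (baseTorsor 𝒳 G).obj Z) z y)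
    refine congrArg ((homOfPoints (Z := (baseTorsor 𝒳 G).obj Z) z y).1 x (𝟙 x)) ?_
    change (h : Z.adSections (𝒳.p.obj x)).1 _ (𝒳.p.map (𝟙 x)) (Z.adAct h⁻¹ z) = z
    rw [𝒳.p.map_id]
    exact Equiv.apply_symm_apply ((h : Z.adSections (𝒳.p.obj x)).1 _ (𝟙 _)) z

end Twisted

/-! ### Čech classes and torsors -/

section CechTorsors

variable {C : Type u₁} [Category.{v₁} C] {J : GrothendieckTopology C}

section CocycleTorsor

variable {T : C} {G : Sheaf J GrpCat.{max w u₁ v₁}} {R : J.Cover T}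

/-- The disjoint union of the presheaves represented by the members of a covering. -/
def coverPresheaf (R : J.Cover T) : Cᵒᵖ ⥤ Type (max u₁ v₁) where
  obj V := Σ I : R.Arrow, (V.unop ⟶ I.Y)
  map k := ↾(fun t => ⟨t.1, k.unop ≫ t.2⟩)
  map_id V := by
    ext t : 3
    exact Sigma.ext rfl (heq_of_eq (Category.id_comp t.2))
  map_comp k l := by
    ext t : 3
    exact Sigma.ext rfl (heq_of_eq (Category.assoc l.unop k.unop t.2))

/-- The presheaf of families `(h_I)` with `h_I = g_{IJ} h_J`: the coordinates, with respect to local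
sections `z_I` with `z_I g_{IJ} = z_J`, of the sections `z_I h_I` of a torsor with cocycle `g`. -/
abbrev cocyclePresheaf (γ : CechCocycle G R) : Cᵒᵖ ⥤ Type (max w u₁ v₁) :=
  homPresheaf (coverPresheaf R) (G.obj ⋙ forget GrpCat) fun V φ =>
    ∀ (I I' : R.Arrow) (a : V ⟶ I.Y) (b : V ⟶ I'.Y),
      (φ ⟨I, a⟩ : G.obj.obj (op V)) = γ.ev I I' a b * (φ ⟨I', b⟩ : G.obj.obj (op V))

lemma isSheaf_cocyclePresheaf (γ : CechCocycle G R) :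
    Presheaf.IsSheaf J (cocyclePresheaf.{w} γ) := by
  refine isSheaf_homPresheaf (isSheaf_forget G) fun V R' hR' φ h I I' a b => ?_
  refine eq_of_locally_eq (isSheaf_forget G) hR' fun W k hk => ?_
  obtain ⟨ψ, hψ, e⟩ := h k hk
  have e1 := e ⟨I, a⟩
  have e2 := e ⟨I', b⟩
  refine e1.trans ((hψ I I' (k ≫ a) (k ≫ b)).trans ?_)
  refine Eq.trans ?_ (map_mul (G.obj.map k.op).hom _ _).symm
  exact congr (congrArg _ (γ.ev_precomp I I' k a b).symm) e2.symm

/-- All coordinates of a section over `V` are determined by a single one, taken at the identity of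
`V` with respect to a morphism `a : V ⟶ I.Y`. -/
lemma cocyclePresheaf_apply (γ : CechCocycle G R) {V : C}
    (φ : (cocyclePresheaf.{w} γ).obj (op V)) {I : R.Arrow} (a : V ⟶ I.Y) {W : C} (k : W ⟶ V)
    {I' : R.Arrow} (b : W ⟶ I'.Y) :
    φ.1 W k ⟨I', b⟩ = γ.ev I' I b (k ≫ a) * G.obj.map k.op (φ.1 V (𝟙 V) ⟨I, a⟩) := by
  refine (φ.2.2 W k I' I b (k ≫ a)).trans (congrArg _ ?_)
  have e := φ.2.1 V W (𝟙 V) k ⟨I, a⟩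
  rw [Category.comp_id] at e
  exact e.symm

lemma cocyclePresheaf_ext (γ : CechCocycle G R) {V : C}
    {φ ψ : (cocyclePresheaf.{w} γ).obj (op V)} {I : R.Arrow} (a : V ⟶ I.Y)
    (h : φ.1 V (𝟙 V) ⟨I, a⟩ = ψ.1 V (𝟙 V) ⟨I, a⟩) : φ = ψ := by
  refine Subtype.ext (funext fun W => funext fun k => funext fun ⟨I', b⟩ => ?_)
  rw [cocyclePresheaf_apply γ φ a, cocyclePresheaf_apply γ ψ a, h]

/-- The restriction along `a : V ⟶ I.Y` of the section `z_I` of the torsor of a cocycle: its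
coordinate at `J` is `g_{JI}`. -/
def cocycleSection (γ : CechCocycle G R) {V : C} {I : R.Arrow} (a : V ⟶ I.Y) :
    (cocyclePresheaf.{w} γ).obj (op V) :=
  ⟨fun W k t => γ.ev t.1 I t.2 (k ≫ a),
    fun V W f k t => by
      refine (γ.ev_precomp t.1 I k t.2 (f ≫ a)).trans ?_
      rw [← Category.assoc]
      rfl,
    fun V f I' I'' b c => (γ.ev_trans I' I'' I b c (f ≫ a)).symm⟩

/-- The torsor with a given cocycle over a covering of the final object. -/
def cocycleTorsor (hT : Limits.IsTerminal T) (γ : CechCocycle G R) : Torsor J G :=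
  Torsor.ofLocally ⟨cocyclePresheaf.{w} γ, isSheaf_cocyclePresheaf γ⟩
    (act := fun {U} φ g => ⟨fun V f t => (φ.1 V f t : G.obj.obj (op V)) * G.obj.map f.op g,
      fun V W f k t => by
        refine (map_mul (G.obj.map k.op).hom _ _).trans ?_
        refine congr (congrArg _ (φ.2.1 V W f k t)) ?_
        exact (map_comp_op (G.obj ⋙ forget GrpCat) f k g).symm,
      fun V f I I' a b =>
        (congrArg (fun h : G.obj.obj (op V) => h * G.obj.map f.op g)
          (φ.2.2 V f I I' a b)).trans (mul_assoc (G := G.obj.obj (op V)) _ _ _)⟩)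
    (act_one := fun {U} φ => by
      refine Subtype.ext (funext fun V => funext fun f => funext fun t => ?_)
      change (φ.1 V f t : G.obj.obj (op V)) * G.obj.map f.op 1 = φ.1 V f t
      rw [map_one, mul_one])
    (act_mul := fun {U} φ g h => by
      refine Subtype.ext (funext fun V => funext fun f => funext fun t => ?_)
      change (φ.1 V f t : G.obj.obj (op V)) * G.obj.map f.op (g * h) =
        φ.1 V f t * G.obj.map f.op g * G.obj.map f.op h
      rw [map_mul, mul_assoc])
    (map_act := fun {U V} f φ g => by
      refine Subtype.ext (funext fun W => funext fun k => funext fun t => ?_)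
      change (φ.1 W (k ≫ f) t : G.obj.obj (op W)) * G.obj.map (k ≫ f).op g =
        φ.1 W (k ≫ f) t * G.obj.map k.op (G.obj.map f.op g)
      exact congrArg _ (map_comp_op (G.obj ⋙ forget GrpCat) f k g))
    (by
      intro U
      refine ⟨R.1.pullback (hT.from U), J.pullback_stable _ R.condition, fun V f hf => ?_⟩
      let I : R.Arrow := ⟨V, f ≫ hT.from U, hf⟩
      let a : V ⟶ I.Y := 𝟙 V
      refine ⟨⟨cocycleSection γ a⟩, fun φ ψ => ?_⟩
      refine ⟨(φ.1 V (𝟙 V) ⟨I, a⟩ : G.obj.obj (op V))⁻¹ * ψ.1 V (𝟙 V) ⟨I, a⟩, ?_, ?_⟩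
      -- Sections over `V` are determined by their coordinate at `(I, a)`, which is arbitrary.
      · refine cocyclePresheaf_ext γ a ?_
        change (φ.1 V (𝟙 V) ⟨I, a⟩ : G.obj.obj (op V)) * G.obj.map (𝟙 V).op _ = _
        rw [op_id, G.obj.map_id]
        exact mul_inv_cancel_left _ _
      · rintro g rfl
        change g = (φ.1 V (𝟙 V) ⟨I, a⟩ : G.obj.obj (op V))⁻¹ *
          (φ.1 V (𝟙 V) ⟨I, a⟩ * G.obj.map (𝟙 V).op g)
        rw [op_id, G.obj.map_id]
        exact (inv_mul_cancel_left _ _).symm)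

end CocycleTorsor

namespace Torsor

/-- Every Čech class is represented by a torsor. -/
lemma exists_represents {G : Sheaf J GrpCat.{max w u₁ v₁}} {T : C} {hT : Limits.IsTerminal T}
    (σ : CechH1 G hT) : ∃ Z : Torsor J G, Z.Represents σ := by
  induction σ using Quotient.inductionOn with | h c => ?_
  obtain ⟨R, γ⟩ := c
  refine ⟨cocycleTorsor.{w} hT γ, R, γ, fun I => cocycleSection γ (𝟙 I.Y), rfl, ?_⟩
  intro I I' V a b
  refine Subtype.ext (funext fun W => funext fun k => funext fun t => ?_)
  change (γ.ev t.1 I t.2 ((k ≫ a) ≫ 𝟙 _) : G.obj.obj (op W)) * G.obj.map k.op (γ.ev I I' a b) =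
    γ.ev t.1 I' t.2 ((k ≫ b) ≫ 𝟙 _)
  rw [γ.ev_precomp, Category.comp_id, Category.comp_id, γ.ev_trans]

variable {G : Sheaf J GrpCat.{w}} {T : C} {hT : Limits.IsTerminal T}

/-- Every torsor represents a Čech class, as it has sections on some covering of the final object.
-/
lemma exists_class (Z : Torsor J G) (hT : Limits.IsTerminal T) :
    ∃ σ : CechH1 G hT, Z.Represents σ := by
  obtain ⟨R, hR, h⟩ := Z.locally_nonempty T
  let R' : J.Cover T := ⟨R, hR⟩
  let z (I : R'.Arrow) : Z.Y.obj.obj (op I.Y) := (h I.f I.hf).some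
  let γ : CechCocycle G R' :=
    { ev := fun I I' V a b => Z.div (Z.Y.obj.map a.op (z I)) (Z.Y.obj.map b.op (z I'))
      ev_precomp := fun I I' V W k a b => by
        rw [map_div, ← map_comp_op, ← map_comp_op]
      ev_trans := fun I I' I'' V a b c => Z.div_mul_div _ _ _ }
  exact ⟨_, R', γ, z, rfl, fun I I' V a b => Z.act_div _ _⟩

/-- Two torsors with the same cocycle with respect to local sections on a covering of the final
object are isomorphic: the equivariant maps `z_I ↦ z'_I` agree on overlaps and glue. -/
lemma nonempty_iso_of_local_sections (hT : Limits.IsTerminal T) {Z Z' : Torsor J G} {R : J.Cover T}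
    (γ : CechCocycle G R) (z : ∀ I : R.Arrow, Z.Y.obj.obj (op I.Y))
    (z' : ∀ I : R.Arrow, Z'.Y.obj.obj (op I.Y))
    (hz : ∀ (I I' : R.Arrow) (V : C) (a : V ⟶ I.Y) (b : V ⟶ I'.Y),
      Z.act (Z.Y.obj.map a.op (z I)) (γ.ev I I' a b) = Z.Y.obj.map b.op (z I'))
    (hz' : ∀ (I I' : R.Arrow) (V : C) (a : V ⟶ I.Y) (b : V ⟶ I'.Y),
      Z'.act (Z'.Y.obj.map a.op (z' I)) (γ.ev I I' a b) = Z'.Y.obj.map b.op (z' I')) :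
    Nonempty (Z ≅ Z') := by
  obtain ⟨φ, -⟩ := exists_amalgamation (isSheaf_equivariantMaps Z Z') R.condition
    (fun V f hf => homOfPoints (z ⟨V, f, hf⟩) (z' ⟨V, f, hf⟩)) (by
      intro V W f k hf
      let I : R.Arrow := ⟨V, f, hf⟩
      let I' : R.Arrow := ⟨W, k ≫ f, R.1.downward_closed hf k⟩
      have e1 := hz I I' W k (𝟙 W)
      have e2 := hz' I I' W k (𝟙 W)
      rw [map_id_op] at e1 e2
      refine equivariantMaps_ext (z I') (Eq.trans ?_ (homOfPoints_apply (z I') (z' I')).symm)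
      change Z'.act (Z'.Y.obj.map (𝟙 W ≫ k).op (z' I))
        (Z.div (Z.Y.obj.map (𝟙 W ≫ k).op (z I)) (z I')) = z' I'
      rw [Category.id_comp, Z.div_eq e1, e2])
  -- As `T` is final, a section over `T` of the sheaf of equivariant maps is a global morphism.
  refine nonempty_iso (Y := Z) (Z := Z')
    ⟨⟨{ app := fun U => ↾(φ.1 U.unop (hT.from U.unop)), naturality := fun U V f => ?_ }⟩,
      fun {U} y g => φ.2.2 U _ y g⟩
  ext y : 3
  have e := φ.2.1 U.unop V.unop (hT.from _) f.unop y
  rw [hT.hom_ext (f.unop ≫ hT.from U.unop) (hT.from V.unop)] at e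
  exact e.symm

/-- Torsors which represent the same Čech class are isomorphic. -/
lemma Represents.nonempty_iso {Z Z' : Torsor J G} {σ : CechH1 G hT} (h : Z.Represents σ)
    (h' : Z'.Represents σ) : Nonempty (Z ≅ Z') := by
  obtain ⟨R, γ, z, rfl, hz⟩ := h
  obtain ⟨R', γ', z', e, hz'⟩ := h'
  obtain ⟨R'', f, f', α, hα⟩ := Quotient.exact e
  -- The sections `z'` are corrected by the cochain `α` to have the cocycle of `z`.
  refine nonempty_iso_of_local_sections hT (CechCocycle.restrict γ f) (fun I => z (I.map f))
    (fun I => Z'.act (z' (I.map f')) (α I)) (fun I I' V a b => hz (I.map f) (I'.map f) V a b) ?_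
  intro I I' V a b
  have e1 := hz' (I.map f') (I'.map f') V a b
  have e2 := hα I I' a b
  refine (congrArg (Z'.act · _) (Z'.map_act a _ _)).trans ?_
  refine Eq.trans ?_ (Z'.map_act b _ _).symm
  refine (Z'.act_mul _ _ _).symm.trans ((congrArg (Z'.act _) e2).trans ?_)
  exact (Z'.act_mul _ _ _).trans (congrArg (Z'.act · _) e1)

end Torsor

end CechTorsors

/-! ### Points of associated fibred categories -/

section Points

variable {𝒮 : Type u₀} [Category.{v₀} 𝒮]

/-- A `1`-morphism lifts to the category associated to the presheaf `P` if and only if the pull-back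
of `P` has a global section. -/
lemma imagePoints_associatedProj_iff {𝒜 : BasedCategory.{v₂, u₂} 𝒮} {𝒳 : BasedCategory.{v₁, u₁} 𝒮}
    (P : 𝒳.objᵒᵖ ⥤ Type w) (x : BasedFunctor 𝒜 𝒳) :
    imagePoints 𝒜 (associatedProj 𝒳 P) x ↔ ∃ s : ∀ a : 𝒜.obj, P.obj (op (x.obj a)),
      ∀ ⦃a b : 𝒜.obj⦄ (k : b ⟶ a), P.map (x.map k).op (s a) = s b := by
  constructor
  · rintro ⟨y, ⟨α⟩⟩
    let sec (a : 𝒜.obj) : P.obj (op ((y.comp (associatedProj 𝒳 P)).obj a)) :=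
      AssociatedObj.sec (y.obj a)
    have hsec {a b : 𝒜.obj} (k : b ⟶ a) :
        P.map ((y.comp (associatedProj 𝒳 P)).map k).op (sec a) = sec b :=
      Subtype.property (y.map k)
    refine ⟨fun a => P.map (α.inv.toNatTrans.app a).op (sec a), fun a b k => ?_⟩
    rw [← map_comp_op, α.inv.toNatTrans.naturality k, map_comp_op, hsec]
  · rintro ⟨s, hs⟩
    exact ⟨{ obj := fun a => (⟨x.obj a, s a⟩ : AssociatedObj 𝒳 P)
             map := fun k => ⟨x.map k, hs k⟩
             map_id := fun a => Subtype.ext (x.map_id a)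
             map_comp := fun k l => Subtype.ext (x.map_comp k l)
             w := x.w }, ⟨Iso.refl x⟩⟩

end Points

/-! ### Points of twists -/

section TwistPoints

variable {𝒮 : Type u₀} [Category.{v₀} 𝒮] {K : GrothendieckTopology 𝒮}
  {𝒜 : BasedCategory.{v₂, u₂} 𝒮} [IsFibredInGroupoids 𝒜]
  {𝒳 : BasedCategory.{v₁, u₁} 𝒮} [IsFibredInGroupoids 𝒳]
  {G : Sheaf K GrpCat.{w}}

/-- The evaluation of a torsor over `𝒳` at an `𝒜`-point of `𝒳`. -/
abbrev evalTorsor (Y : TorsorOver 𝒳 G) (x : BasedFunctor 𝒜 𝒳) : TorsorOver 𝒜 G :=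
  (Torsor.pullback x.toFunctor (groupIso G x)).obj Y

/-- The pull-back of a torsor on the base along `𝒜 → 𝒳 → 𝒮` is its pull-back along `𝒜 → 𝒮`. The
identification is not the identity as `𝒳.p.obj (x.obj a)` and `𝒜.p.obj a` agree only
propositionally. -/
def baseTorsorHom (Z : Torsor K G) (x : BasedFunctor 𝒜 𝒳) :
    (baseTorsor 𝒜 G).obj Z ⟶ evalTorsor ((baseTorsor 𝒳 G).obj Z) x :=
  ⟨⟨{ app := fun a => Z.Y.obj.map (eqToHom (x.w_obj a.unop)).op
      naturality := fun a b f => by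
        have h : 𝒳.p.map (x.map f.unop) = eqToHom (x.w_obj b.unop) ≫ 𝒜.p.map f.unop ≫
          eqToHom (x.w_obj a.unop).symm := by simpa using Functor.congr_hom x.w f.unop
        change Z.Y.obj.map (𝒜.p.map f.unop).op ≫ Z.Y.obj.map (eqToHom (x.w_obj b.unop)).op =
          Z.Y.obj.map (eqToHom (x.w_obj a.unop)).op ≫ Z.Y.obj.map (𝒳.p.map (x.map f.unop)).op
        rw [← Functor.map_comp, ← Functor.map_comp, ← op_comp, ← op_comp, h]
        simp }⟩,
    fun z g => Z.map_act _ z g⟩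

variable {Y : TorsorOver 𝒳 G} {T : 𝒮} {hT : Limits.IsTerminal T} {σ : CechH1 G hT}

namespace Twist

variable (t : Twist Y σ)

/-- The class of a pair `(y, z)` in the twisted torsor. -/
abbrev pairMk {x : 𝒳.obj} (y : Y.Y.obj.obj (op x))
    (z : ((baseTorsor 𝒳 G).obj t.Z).Y.obj.obj (op x)) :
    t.torsor.Y.obj.obj (op x) :=
  t.proj.app (op x) (orbitMk Y ((baseTorsor 𝒳 G).obj t.Z) y z)

lemma pairMk_act {x : 𝒳.obj} (y : Y.Y.obj.obj (op x))
    (z : ((baseTorsor 𝒳 G).obj t.Z).Y.obj.obj (op x)) (g : (groupOn 𝒳 G).obj.obj (op x)) :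
    t.pairMk (Y.act y g) (((baseTorsor 𝒳 G).obj t.Z).act z g) = t.pairMk y z := by
  refine congrArg (t.proj.app (op x)) (Quotient.sound ⟨g⁻¹, Prod.ext ?_ ?_⟩)
  · simp [← Y.act_mul, Y.act_one]
  · simp [Torsor.invAct, ← Torsor.act_mul, Torsor.act_one]

lemma map_pairMk {x x' : 𝒳.obj} (f : x' ⟶ x) (y : Y.Y.obj.obj (op x))
    (z : ((baseTorsor 𝒳 G).obj t.Z).Y.obj.obj (op x)) :
    t.torsor.Y.obj.map f.op (t.pairMk y z) =
      t.pairMk (Y.Y.obj.map f.op y) (((baseTorsor 𝒳 G).obj t.Z).Y.obj.map f.op z) :=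
  (NatTrans.naturality_apply t.proj f.op _).symm

/-- As the action on `Z` is free, pairs with the same `z` are in the same orbit only if equal. -/
lemma pairMk_injective {x : 𝒳.obj} {y y' : Y.Y.obj.obj (op x)}
    {z : ((baseTorsor 𝒳 G).obj t.Z).Y.obj.obj (op x)} (e : t.pairMk y z = t.pairMk y' z) :
    y = y' := by
  have := t.isLocallyInjective
  refine eq_of_locally_eq Y.Y.property
    (Presheaf.equalizerSieve_mem (inheritedTopology K 𝒳) t.proj _ _ e) fun x' f hf => ?_
  obtain ⟨g, hg⟩ := Quotient.exact hf
  have h1 := congrArg Prod.fst hg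
  have h2 := congrArg Prod.snd hg
  simp only [Torsor.invAct, inv_inv] at h1 h2
  have h3 := ((baseTorsor 𝒳 G).obj t.Z).act_injective ((Torsor.act_one _ _).trans h2)
  rw [h1, ← h3, Y.act_one]

/-- Every section of the twist is of the form `[y, z]` once a section `z` of `Z` is chosen. It is so
locally, up to moving `[y', z']` within its orbit, and the local `y` glue as they are unique. -/
lemma exists_pairMk_eq {x : 𝒳.obj} (s : t.torsor.Y.obj.obj (op x))
    (z : ((baseTorsor 𝒳 G).obj t.Z).Y.obj.obj (op x)) : ∃ y, t.pairMk y z = s := by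
  have := t.isLocallySurjective
  have hR := Presheaf.imageSieve_mem (inheritedTopology K 𝒳) t.proj s
  obtain ⟨y, hy⟩ := exists_of_locally_existsUnique Y.Y.property
    (fun x' f y => t.pairMk y (((baseTorsor 𝒳 G).obj t.Z).Y.obj.map f.op z) =
      t.torsor.Y.obj.map f.op s)
    (fun x' x'' f k y e => by rw [map_comp_op, map_comp_op, ← map_pairMk, e])
    (fun x' f y y' e e' => t.pairMk_injective (e.trans e'.symm)) hR (fun x' f hf => by
      obtain ⟨q, hq⟩ := hf
      induction q using Quotient.inductionOn with | h p => ?_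
      obtain ⟨y, z'⟩ := p
      have e := t.pairMk_act y z' (((baseTorsor 𝒳 G).obj t.Z).div z'
        (((baseTorsor 𝒳 G).obj t.Z).Y.obj.map f.op z))
      rw [Torsor.act_div] at e
      exact ⟨_, e.trans hq⟩)
  refine ⟨y, eq_of_locally_eq t.torsor.Y.property hR fun x' f hf => ?_⟩
  rw [map_pairMk, hy f hf]

section Eval

variable (x : BasedFunctor 𝒜 𝒳)

/-- The class, in the value at `x` of the twisted torsor, of a section of the value of `Y` and a
section of the pull-back of `Z` to `𝒜`. -/
def evalMk {a : 𝒜.obj} (y : (evalTorsor Y x).Y.obj.obj (op a))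
    (z : ((baseTorsor 𝒜 G).obj t.Z).Y.obj.obj (op a)) : t.torsor.Y.obj.obj (op (x.obj a)) :=
  t.pairMk y ((baseTorsorHom t.Z x).hom.hom.app (op a) z)

lemma evalMk_act {a : 𝒜.obj} (y : (evalTorsor Y x).Y.obj.obj (op a))
    (z : ((baseTorsor 𝒜 G).obj t.Z).Y.obj.obj (op a)) (g : (groupOn 𝒜 G).obj.obj (op a)) :
    t.evalMk x ((evalTorsor Y x).act y g) (((baseTorsor 𝒜 G).obj t.Z).act z g) =
      t.evalMk x y z := by
  refine (congrArg (t.pairMk _) ((baseTorsorHom t.Z x).hom_act z g)).trans ?_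
  exact t.pairMk_act y _ ((groupIso G x).hom.app (op a) g)

lemma map_evalMk {a b : 𝒜.obj} (k : b ⟶ a) (y : (evalTorsor Y x).Y.obj.obj (op a))
    (z : ((baseTorsor 𝒜 G).obj t.Z).Y.obj.obj (op a)) :
    t.torsor.Y.obj.map (x.map k).op (t.evalMk x y z) =
      t.evalMk x ((evalTorsor Y x).Y.obj.map k.op y)
        (((baseTorsor 𝒜 G).obj t.Z).Y.obj.map k.op z) := by
  refine (t.map_pairMk (x.map k) _ _).trans (congrArg (t.pairMk _) ?_)
  exact (NatTrans.naturality_apply (baseTorsorHom t.Z x).hom.hom k.op z).symm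

end Eval

lemma exists_hom_of_points {x : BasedFunctor 𝒜 𝒳} (h : t.points 𝒜 x) :
    Nonempty ((baseTorsor 𝒜 G).obj t.Z ⟶ evalTorsor Y x) := by
  -- A section `s` of the twist is the equivariant map `z ↦ y` with `s = [y, z]`.
  obtain ⟨s, hs⟩ := (imagePoints_associatedProj_iff _ _).1 h
  choose φ hφ using fun (a : 𝒜.obj) (z : ((baseTorsor 𝒜 G).obj t.Z).Y.obj.obj (op a)) =>
    t.exists_pairMk_eq (s a) ((baseTorsorHom t.Z x).hom.hom.app (op a) z)
  have φ_eq {a : 𝒜.obj} (y : (evalTorsor Y x).Y.obj.obj (op a)) (z) (e : t.evalMk x y z = s a) :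
      φ a z = y := t.pairMk_injective ((hφ a z).trans e.symm)
  refine ⟨⟨⟨{ app := fun a => ↾(φ a.unop), naturality := fun a b k => ?_ }⟩,
    fun {a} z g => ?_⟩⟩
  · ext z : 3
    refine φ_eq _ _ ((t.map_evalMk x k.unop _ z).symm.trans ?_)
    exact (congrArg _ (hφ a.unop z)).trans (hs k.unop)
  · exact φ_eq _ _ ((t.evalMk_act x _ z g).trans (hφ a z))

lemma points_of_hom {x : BasedFunctor 𝒜 𝒳}
    (f : (baseTorsor 𝒜 G).obj t.Z ⟶ evalTorsor Y x) : t.points 𝒜 x := by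
  -- The section of the twist over `a` is the class of `(f z, z)`, for any local section `z` of `Z`.
  let P := ((x.toFunctor.sheafPushforwardContinuous (Type w) (inheritedTopology K 𝒜)
    (inheritedTopology K 𝒳)).obj t.torsor.Y)
  let m {a : 𝒜.obj} (z : ((baseTorsor 𝒜 G).obj t.Z).Y.obj.obj (op a)) : P.obj.obj (op a) :=
    t.evalMk x (f.hom.hom.app (op a) z) z
  have map_m {a b : 𝒜.obj} (k : b ⟶ a) (z) :
      P.obj.map k.op (m z) = m (((baseTorsor 𝒜 G).obj t.Z).Y.obj.map k.op z) :=
    (t.map_evalMk x k _ z).trans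
      (congrArg (t.evalMk x · _) (NatTrans.naturality_apply f.hom.hom k.op z).symm)
  have m_eq {a : 𝒜.obj} (z z' : ((baseTorsor 𝒜 G).obj t.Z).Y.obj.obj (op a)) : m z = m z' := by
    have e := t.evalMk_act x (f.hom.hom.app (op a) z) z (((baseTorsor 𝒜 G).obj t.Z).div z z')
    rw [← f.hom_act, Torsor.act_div] at e
    exact e.symm
  have hP {a : 𝒜.obj} {s s' : P.obj.obj (op a)}
      (h : ∀ ⦃b : 𝒜.obj⦄ (k : b ⟶ a) (z : ((baseTorsor 𝒜 G).obj t.Z).Y.obj.obj (op b)),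
        P.obj.map k.op s = P.obj.map k.op s') : s = s' := by
    obtain ⟨R, hR, hz⟩ := ((baseTorsor 𝒜 G).obj t.Z).locally_nonempty a
    exact eq_of_locally_eq P.property hR fun b k hk => h k (hz k hk).some
  have key (a : 𝒜.obj) : ∃ s : P.obj.obj (op a), ∀ ⦃b : 𝒜.obj⦄ (k : b ⟶ a)
      (z : ((baseTorsor 𝒜 G).obj t.Z).Y.obj.obj (op b)), P.obj.map k.op s = m z := by
    obtain ⟨R, hR, hz⟩ := ((baseTorsor 𝒜 G).obj t.Z).locally_nonempty a
    obtain ⟨s, hs⟩ := exists_amalgamation P.property hR (fun b k hk => m (hz k hk).some)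
      (fun b c k l hk => (map_m l _).trans (m_eq _ _))
    refine ⟨s, fun b k z => ?_⟩
    refine eq_of_locally_eq P.property ((inheritedTopology K 𝒜).pullback_stable k hR)
      fun c l hl => ?_
    rw [map_m, ← map_comp_op]
    exact (hs (l ≫ k) hl).trans (m_eq _ _)
  choose s hs using key
  refine (imagePoints_associatedProj_iff _ _).2 ⟨s, fun a b k => ?_⟩
  refine hP (s := P.obj.map k.op (s a)) fun c l z => ?_
  rw [← map_comp_op, hs a _ z, hs b _ z]

end Twist

/-- The points of the twists of `Y` are those at which the value of `Y` comes from the base. -/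
lemma exists_points_iff (t : ∀ σ : CechH1 G hT, Twist Y σ) (x : BasedFunctor 𝒜 𝒳) :
    (∃ σ, (t σ).points 𝒜 x) ↔
      ∃ Z : Torsor K G, Nonempty ((baseTorsor 𝒜 G).obj Z ⟶ evalTorsor Y x) := by
  refine ⟨fun ⟨σ, h⟩ => ⟨(t σ).Z, (t σ).exists_hom_of_points h⟩, fun ⟨Z, ⟨f⟩⟩ => ?_⟩
  obtain ⟨σ, hσ⟩ := Z.exists_class hT
  obtain ⟨i⟩ := (t σ).represents.nonempty_iso hσ
  exact ⟨σ, (t σ).points_of_hom ((baseTorsor 𝒜 G).map i.hom ≫ f)⟩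

/-- The condition on classes may be stated with a morphism of torsors, as this is an isomorphism. -/
lemma obstruction_cls_iff (Y : TorsorOver 𝒳 G) (x : BasedFunctor 𝒜 𝒳) :
    obstruction 𝒜 Y.cls x ↔
      ∃ Z : Torsor K G, Nonempty ((baseTorsor 𝒜 G).obj Z ⟶ evalTorsor Y x) := by
  constructor
  · rintro ⟨c, hc⟩
    induction c using Quotient.inductionOn with | h Z => ?_
    obtain ⟨i⟩ : Nonempty ((baseTorsor 𝒜 G).obj Z ≅ evalTorsor Y x) := Quotient.exact hc
    exact ⟨Z, ⟨i.hom⟩⟩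
  · rintro ⟨Z, ⟨f⟩⟩
    exact ⟨Z.cls, Quotient.sound (Torsor.nonempty_iso f)⟩

/-- The obstruction given by the class of `Y` is the union of the sets of points of its twists. -/
theorem obstruction_eq_iSup_points (t : ∀ σ : CechH1 G hT, Twist Y σ) :
    obstruction 𝒜 Y.cls = ⨆ σ, (t σ).points 𝒜 := by
  ext x
  rw [obstruction_cls_iff, ← exists_points_iff t]
  simp

/-- Torsors over `𝒮`, considered as a category fibred over itself, come from the base. The data are
the same, but the inherited topology is only propositionally equal to `K`. -/
lemma exists_baseTorsor_hom (Y : TorsorOver (baseCategory 𝒮) G) :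
    ∃ Z : Torsor K G, Nonempty ((baseTorsor (baseCategory 𝒮) G).obj Z ⟶ Y) := by
  have hK := inheritedTopology_baseCategory K
  refine ⟨{ Y := ⟨Y.Y.obj, Presheaf.IsSheaf.of_le hK.ge Y.Y.property⟩
            act := fun y g => Y.act y g
            act_one := fun y => Y.act_one y
            act_mul := fun y g h => Y.act_mul y g h
            map_act := fun f y g => Y.map_act f y g
            locally_nonempty := fun U => by
              obtain ⟨R, hR, h⟩ := Y.locally_nonempty U
              exact ⟨R, hK.le U hR, h⟩
            bijective := fun U => Y.bijective U }, ⟨⟨𝟙 Y.Y.obj⟩, fun y g => rfl⟩⟩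

/-- Every point over the base lifts to a twist. -/
theorem top_eq_iSup_points (t : ∀ σ : CechH1 G hT, Twist Y σ) :
    (⊤ : ObjectProperty (BasedFunctor (baseCategory 𝒮) 𝒳)) =
      ⨆ σ, (t σ).points (baseCategory 𝒮) := by
  ext x
  simpa using (exists_points_iff t x).2 (exists_baseTorsor_hom (evalTorsor Y x))

end TwistPoints

end DescentByTorsors

theorem proposition3p10 (S : Scheme.{u})
    (𝒜 : BasedCategory.{v₂, u₂} (Over S)) [IsFibredInSets 𝒜]
    (𝒳 : BasedCategory.{v₁, u₁} (Over S)) [IsFibredInSetoids 𝒳] :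
    (∀ (τ : TopologyKind) (G : Sheaf (τ.topology S) GrpCat.{max w (u + 1) v₁ u₁})
      (Y : TorsorOver 𝒳 G),
      (∀ σ : CechH1Over G, Nonempty (Twist Y σ)) ∧
      ∀ t : ∀ σ : CechH1Over G, Twist Y σ,
        (obstruction 𝒜 Y.cls = ⨆ σ : CechH1Over G, (t σ).points 𝒜) ∧
        ((⊤ : ObjectProperty (BasedFunctor (baseCategory (Over S)) 𝒳)) =
          ⨆ σ : CechH1Over G, (t σ).points (baseCategory (Over S)))) ∧
    ∀ t : ∀ (G : Sheaf (TopologyKind.fppf.topology S) GrpCat.{max w (u + 1) v₁ u₁})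
        (Y : TorsorOver 𝒳 G) (σ : CechH1Over G), Twist Y σ,
      descentCategory.{max w (u + 1) v₁ u₁} 𝒜 𝒳 =
        ⨅ (G : Sheaf (TopologyKind.fppf.topology S) GrpCat.{max w (u + 1) v₁ u₁})
          (Y : TorsorOver 𝒳 G), ⨆ σ : CechH1Over G, (t G Y σ).points 𝒜 := by
  refine ⟨fun τ G Y => ⟨fun σ => ?_, fun t => ⟨obstruction_eq_iSup_points t, top_eq_iSup_points t⟩⟩,
    fun t => ?_⟩
  · obtain ⟨Z, hZ⟩ := Torsor.exists_represents.{max w v₁ u₁} σ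
    exact ⟨twistOfRepresents.{w} Y Z hZ⟩
  · refine iInf_congr fun G => ?_
    refine Eq.trans ?_ (iInf_congr fun Y => obstruction_eq_iSup_points (t G Y))
    -- Every class of torsors over `𝒳` is the class of some `Y`.
    exact (Quotient.mk_surjective (s := isIsomorphicSetoid (TorsorOver 𝒳 G))).iInf_comp
      (fun A => obstruction 𝒜 A) |>.symm
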